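/- Let $K$ be an algebraically closed field of characteristic $0$. Let $\mathcal Z\subset K^3$ be an irreducible affine algebraic surface with defining (irreducible) polynomial $f(x,y,z)$, not a plane parallel to a coordinate plane, and let $$\mathcal Q(t,s)=\left(\frac{N_1}{D_1},\frac{N_2}{D_2},\frac{N_3}{D_3}\right),\qquad N_i,D_i\in K[t,s],\ D_i\neq 0,\ \gcd(N_i,D_i)=1,$$ be a rational parametrization of $\mathcal Z$ (not necessarily proper), i.e. $\mathcal Z$ is the Zariski closure of the set of points $\mathcal Q(t_0,s_0)$ with $D_1D_2D_3(t_0,s_0)\ne0$. Let $A=(a,b,c)\in K^3$. Put $\deg(\mathcal Z)=\deg f$, and let $\operatorname{mult}(A,\mathcal Z)$ be the least degree of a nonzero homogeneous component of $f(x+a,y+b,z+c)$ (so it is $0$ if $A\notin\mathcal Z$). Let $$\Phi_{2,3}(A)=(\chi_1,\chi_2)=\left(\frac{N_2-bD_2}{N_1-aD_1}\cdot\frac{D_1}{D_2},\ \frac{N_3-cD_3}{N_1-aD_1}\cdot\frac{D_1}{D_3}\right).$$ With new variables $h_1,h_2$, let $g_i\in K[h_1,h_2][t,s]$ be the numerator,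 in reduced form, of $\chi_i(t,s)-\chi_i(h_1,h_2)$ for $i=1,2$, and let $G=\gcd(g_1,g_2)$. Define $\mathfrak g^{\mathcal Q,A}=G$ if $G$ has positive degree in $\{t,s\}$, and $\mathfrak g^{\mathcal Q,A}=1$ otherwise. For a tuple $\Theta=(\theta_1,\dots,\theta_n)$ of elements of $K(t,s)$ with $K(t,s)$ finite over $K(\theta_1,\dots,\theta_n)$, let $\deg(\Theta)=[K(t,s):K(\theta_1,\dots,\theta_n)]$ be the degree of the rational map $\Theta$. Assume that none of the projective plane curves defined (after homogenization, with the third coordinate as homogenizing variable) by the non-constant polynomials among $$N_1,N_2,N_3,D_1,D_2,D_3,\ N_1-aD_1,\ N_2-bD_2,\ N_3-cD_3$$ passes through the point $(0:1:0)$. Then: 1. $\operatorname{mult}(A,\mathcal Z)=\deg(\mathcal Z)$ if and only if $\mathfrak g^{\mathcal Q,A}\neq 1$. 2. $\operatorname{mult}(A,\mathcal Z)<\deg(\mathcal Z)$ if and only if $\mathfrak g^{\mathcal Q,A}=1$. Furthermore, if $\mathfrak g^{\mathcal Q,A}=1$, then $$\deg(\mathcal Z)-\operatorname{mult}(A,\mathcal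 Z)=\frac{\deg(\Phi_{2,3}(A))}{\deg(\mathcal Q)}.$$ -/

import Mathlib

noncomputable section

namespace RatSurf

open MvPolynomial

variable {K : Type*} [Field K]

/-! ### Affine surfaces in `K³`, degree and multiplicity -/

/-- `f` is a defining polynomial of the irreducible affine surface `Z ⊆ K³`: it is irreducible and
`Z` is its zero set. -/
def IsDefiningPolynomial (Z : Set (Fin 3 → K)) (f : MvPolynomial (Fin 3) K) : Prop :=
  Irreducible f ∧ Z = {x | eval x f = 0}

/-- `Z` is an irreducible affine algebraic surface in `K³`. -/
def IsSurface (Z : Set (Fin 3 → K)) : Prop := ∃ f, IsDefiningPolynomial Z f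

/-- Over an algebraically closed field the defining polynomial of a surface is unique up to a
nonzero constant factor. -/
theorem IsDefiningPolynomial.associated [IsAlgClosed K] {Z : Set (Fin 3 → K)}
    {f g : MvPolynomial (Fin 3) K} (hf : IsDefiningPolynomial Z f)
    (hg : IsDefiningPolynomial Z g) : Associated f g := by
  have key : ∀ p : MvPolynomial (Fin 3) K, IsDefiningPolynomial Z p →
      vanishingIdeal K Z = Ideal.span {p} := by
    intro p hp
    have hprime : (Ideal.span {p}).IsPrime :=
      (Ideal.span_singleton_prime hp.1.ne_zero).2 hp.1.prime
    have hZ : Z = zeroLocus K (Ideal.span {p}) := by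
      rw [zeroLocus_span, hp.2]
      ext x
      simp [aeval_eq_eval]
    rw [hZ, vanishingIdeal_zeroLocus_eq_radical, hprime.radical]
  exact Ideal.span_singleton_eq_span_singleton.1 ((key f hf).symm.trans (key g hg))

/-- The defining polynomial of a surface `Z` (a choice among the associated ones). -/
def definingPolynomial (Z : Set (Fin 3 → K)) : MvPolynomial (Fin 3) K :=
  Classical.epsilon (IsDefiningPolynomial Z)

theorem definingPolynomial_spec {Z : Set (Fin 3 → K)} (hZ : IsSurface Z) :
    IsDefiningPolynomial Z (definingPolynomial Z) :=
  Classical.epsilon_spec hZ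

/-- The degree of a surface. -/
def surfaceDegree (Z : Set (Fin 3 → K)) : ℕ := (definingPolynomial Z).totalDegree

/-- The polynomial `f(x + a, y + b, z + c)`, where `A = (a, b, c)`. -/
def translate (A : Fin 3 → K) (f : MvPolynomial (Fin 3) K) : MvPolynomial (Fin 3) K :=
  aeval (fun i => X i + C (A i)) f

/-- The multiplicity of a point `A ∈ K³` on the surface `Z`: the least degree of a nonzero
homogeneous component of `f(x + a, y + b, z + c)`, `f` being the defining polynomial of `Z`.
It is `0` when `A ∉ Z`. -/
def mult (A : Fin 3 → K) (Z : Set (Fin 3 → K)) : ℕ :=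
  sInf {k : ℕ | homogeneousComponent k (translate A (definingPolynomial Z)) ≠ 0}

/-! ### Rational parametrizations -/

/-- The image of the rational map `(N₁/D₁, N₂/D₂, N₃/D₃)` on the set where all denominators are
nonzero. -/
def paramImage (N D : Fin 3 → MvPolynomial (Fin 2) K) : Set (Fin 3 → K) :=
  {x | ∃ p : Fin 2 → K, (∀ i, eval p (D i) ≠ 0) ∧ ∀ i, x i = eval p (N i) / eval p (D i)}

/-- `(N₁/D₁, N₂/D₂, N₃/D₃)` is a rational parametrization in reduced form of `Z`: numerators and
denominators are coprime, and `Z` is the Zariski closure of the image. -/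
structure IsRationalParametrization (N D : Fin 3 → MvPolynomial (Fin 2) K)
    (Z : Set (Fin 3 → K)) : Prop where
  den_ne_zero : ∀ i, D i ≠ 0
  reduced : ∀ i, IsRelPrime (N i) (D i)
  closure_image : Z = zeroLocus K (vanishingIdeal K (paramImage N D))

/-! ### The plane curve of a polynomial at the point `(0:1:0)` -/

/-- The homogenization `v^d p(t/v, s/v)`, `d = deg p`, with variables `0 ↦ t`, `1 ↦ s`, `2 ↦ v`. -/
def homogenization (p : MvPolynomial (Fin 2) K) : MvPolynomial (Fin 3) K :=
  ∑ k ∈ Finset.range (p.totalDegree + 1),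
    rename Fin.castSucc (homogeneousComponent k p) * X 2 ^ (p.totalDegree - k)

/-- If `p` is non-constant, then the projective curve defined by `p` does not pass through
`(0:1:0)`. -/
def AvoidsInfinitePoint (p : MvPolynomial (Fin 2) K) : Prop :=
  (¬ ∃ c : K, p = C c) → eval ![0, 1, 0] (homogenization p) ≠ 0

/-! ### Rational maps and their degrees -/

variable (K) in
/-- The polynomial ring `K[t, s]`. -/
abbrev Poly2 := MvPolynomial (Fin 2) K

variable (K) in
/-- The field of rational functions `K(t, s)`. -/
abbrev Rat2 := FractionRing (Poly2 K)

/-- The degree `[K(t,s) : K(θ₁, …, θₙ)]` of the rational map with components `θ₁, …, θₙ ∈ K(t,s)`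
from `K²` to the closure of its image (`0` if the extension is infinite, that is, if the image
has dimension less than two). -/
def ratMapDegree {n : ℕ} (θ : Fin n → Rat2 K) : ℕ :=
  Module.finrank (IntermediateField.adjoin K (Set.range θ)) (Rat2 K)

/-- The components `Nᵢ/Dᵢ ∈ K(t,s)` of the parametrization. -/
def paramMap (N D : Fin 3 → Poly2 K) : Fin 3 → Rat2 K :=
  fun i => algebraMap (Poly2 K) (Rat2 K) (N i) / algebraMap (Poly2 K) (Rat2 K) (D i)

/-- The rational map
`Φ₂₃(A) = ((N₂ - b D₂)/(N₁ - a D₁) · D₁/D₂, (N₃ - c D₃)/(N₁ - a D₁) · D₁/D₃)`, `A = (a, b, c)`. -/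
def Phi23 (N D : Fin 3 → Poly2 K) (A : Fin 3 → K) : Fin 2 → Rat2 K :=
  let ι := algebraMap (Poly2 K) (Rat2 K)
  ![ι (N 1 - C (A 1) * D 1) / ι (N 0 - C (A 0) * D 0) * (ι (D 0) / ι (D 1)),
    ι (N 2 - C (A 2) * D 2) / ι (N 0 - C (A 0) * D 0) * (ι (D 0) / ι (D 2))]

/-! ### The gcd polynomial -/

variable (K) in
/-- The polynomial ring `K[h₁, h₂][t, s]`: the coefficients are polynomials in `h₁, h₂`. -/
abbrev Poly4 := MvPolynomial (Fin 2) (MvPolynomial (Fin 2) K)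

variable (K) in
/-- The field of rational functions `K(t, s, h₁, h₂)`. -/
abbrev Rat4 := FractionRing (Poly4 K)

variable (K) in
/-- The inclusion of `K(t, s)` into `K(t, s, h₁, h₂)`, `χ(t, s) ↦ χ(t, s)`. -/
def inTS : Rat2 K →+* Rat4 K :=
  IsFractionRing.map (A := Poly2 K) (B := Poly4 K)
    (map_injective (C : K →+* MvPolynomial (Fin 2) K) (C_injective _ _))

variable (K) in
/-- The embedding of `K(t, s)` into `K(t, s, h₁, h₂)` given by `χ(t, s) ↦ χ(h₁, h₂)`. -/
def inH : Rat2 K →+* Rat4 K :=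
  IsFractionRing.map (A := Poly2 K) (B := Poly4 K)
    (j := (C : MvPolynomial (Fin 2) K →+* Poly4 K)) (C_injective _ _)

/-- The polynomial `numer(χ(t, s) - χ(h₁, h₂))`, the numerator being that of the reduced form. -/
def diffNumer (χ : Rat2 K) : Poly4 K := IsFractionRing.num (Poly4 K) (inTS K χ - inH K χ)

/-- A greatest common divisor in `K[h₁, h₂][t, s]`. -/
def polyGcd (p q : Poly4 K) : Poly4 K :=
  letI : GCDMonoid (Poly4 K) := UniqueFactorizationMonoid.toGCDMonoid (Poly4 K)
  gcd p q

/-- The gcd polynomial of the parametrization and the point `A`: the gcd of the numerators of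
`χᵢ(t, s) - χᵢ(h₁, h₂)`, `i = 1, 2`, where `(χ₁, χ₂) = Φ₂₃(A)`, if that gcd has positive degree
in `t, s`, and `1` otherwise. -/
def gcdPolynomial (N D : Fin 3 → Poly2 K) (A : Fin 3 → K) : Poly4 K :=
  let G := polyGcd (diffNumer (Phi23 N D A 0)) (diffNumer (Phi23 N D A 1))
  if 0 < G.totalDegree then G else 1

end RatSurf

end

noncomputable section

namespace RatSurf

open MvPolynomial

universe u

section Grading

variable {σ K A : Type*} [Field K] [CommRing A] [Algebra K A]

/-- The polynomial `F(T x₁, …, T xₙ)` in the variable `T`; its coefficients are the homogeneous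
components of `F`. -/
def gradingPoly : MvPolynomial σ K →ₐ[K] Polynomial (MvPolynomial σ K) :=
  aeval fun i => Polynomial.C (X i) * Polynomial.X

theorem gradingPoly_monomial (m : σ →₀ ℕ) (c : K) :
    gradingPoly (monomial m c) = Polynomial.C (monomial m c) * Polynomial.X ^ m.degree := by
  rw [gradingPoly, aeval_monomial, monomial_eq, Finsupp.degree_apply]
  simp only [Finsupp.prod, mul_pow, Finset.prod_mul_distrib, Finset.prod_pow_eq_pow_sum, map_mul,
    map_prod, map_pow, mul_assoc]
  rfl

theorem coeff_gradingPoly (F : MvPolynomial σ K) (k : ℕ) :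
    (gradingPoly F).coeff k = homogeneousComponent k F := by
  induction F using MvPolynomial.induction_on' with
  | monomial m c =>
    rw [gradingPoly_monomial, Polynomial.coeff_C_mul_X_pow,
      homogeneousComponent_of_mem (isHomogeneous_monomial c rfl)]
  | add p q hp hq => simp [hp, hq]

theorem gradingPoly_injective :
    Function.Injective (gradingPoly : MvPolynomial σ K → Polynomial (MvPolynomial σ K)) := by
  rw [injective_iff_map_eq_zero]
  intro F h
  rw [← sum_homogeneousComponent F]
  exact Finset.sum_eq_zero fun k _ => by rw [← coeff_gradingPoly, h, Polynomial.coeff_zero]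

theorem gradingPoly_ne_zero {F : MvPolynomial σ K} (hF : F ≠ 0) : gradingPoly F ≠ 0 :=
  (map_ne_zero_iff _ gradingPoly_injective).2 hF

theorem natDegree_gradingPoly (F : MvPolynomial σ K) :
    (gradingPoly F).natDegree = F.totalDegree := by
  refine le_antisymm (Polynomial.natDegree_le_iff_coeff_eq_zero.2 fun k hk => ?_) ?_
  · rw [coeff_gradingPoly, homogeneousComponent_eq_zero _ _ hk]
  · refine Finset.sup_le fun m hm => ?_
    refine Polynomial.le_natDegree_of_ne_zero fun h => ?_
    rw [coeff_gradingPoly] at h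
    have := congrArg (coeff m) h
    rw [coeff_homogeneousComponent, if_pos (show m.degree = m.sum fun _ e => e from rfl)] at this
    exact mem_support_iff.1 hm this

theorem gradingPoly_of_isHomogeneous {F : MvPolynomial σ K} {k : ℕ} (hF : F.IsHomogeneous k) :
    gradingPoly F = Polynomial.C F * Polynomial.X ^ k := by
  ext1 n
  rw [coeff_gradingPoly, Polynomial.coeff_C_mul_X_pow, homogeneousComponent_of_mem hF]

theorem isHomogeneous_of_natDegree_le {F : MvPolynomial σ K}
    (h : (gradingPoly F).natDegree ≤ (gradingPoly F).natTrailingDegree) :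
    F.IsHomogeneous F.totalDegree := by
  have hF : F = homogeneousComponent F.totalDegree F := by
    conv_lhs => rw [← sum_homogeneousComponent F]
    refine Finset.sum_eq_single _ (fun k hk hne => ?_) (fun h => by simp at h)
    rw [natDegree_gradingPoly] at h
    rw [← coeff_gradingPoly, Polynomial.coeff_eq_zero_of_lt_natTrailingDegree]
    have := Finset.mem_range.1 hk
    omega
  have h1 := homogeneousComponent_isHomogeneous F.totalDegree F
  rwa [← hF] at h1

theorem eval₂_gradingPoly (y : σ → A) (r : A) (F : MvPolynomial σ K) :
    (gradingPoly F).eval₂ (aeval y : MvPolynomial σ K →ₐ[K] A).toRingHom r =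
      aeval (fun i => y i * r) F := by
  induction F using MvPolynomial.induction_on with
  | C c =>
    have : gradingPoly (C c : MvPolynomial σ K) = Polynomial.C (C c) := by
      simp [gradingPoly, IsScalarTower.algebraMap_apply K (MvPolynomial σ K)
        (Polynomial (MvPolynomial σ K)), MvPolynomial.algebraMap_eq]
    simp [this]
  | add p q hp hq => rw [map_add, Polynomial.eval₂_add, hp, hq, map_add]
  | mul_X p i hp =>
    have : gradingPoly (X i : MvPolynomial σ K) = Polynomial.C (X i) * Polynomial.X := by
      simp [gradingPoly]
    rw [map_mul, Polynomial.eval₂_mul, hp, this]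
    simp

theorem aeval_mul_of_isHomogeneous {F : MvPolynomial σ K} {k : ℕ} (hF : F.IsHomogeneous k)
    (y : σ → A) (r : A) : aeval (fun i => y i * r) F = aeval y F * r ^ k := by
  rw [← eval₂_gradingPoly, gradingPoly_of_isHomogeneous hF]
  simp

end Grading

section Dehomogenization

variable {K A : Type*} [Field K] [CommRing A] [Algebra K A] {n : ℕ}

/-- Substitution of `1` for the first variable. -/
def dehomogenize : MvPolynomial (Fin (n + 1)) K →ₐ[K] MvPolynomial (Fin n) K :=
  aeval (Fin.cons 1 X)

theorem aeval_dehomogenize (χ : Fin n → A) (F : MvPolynomial (Fin (n + 1)) K) :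
    aeval χ (dehomogenize F) = aeval (Fin.cons 1 χ : Fin (n + 1) → A) F := by
  have h : (aeval χ).comp dehomogenize =
      (aeval (Fin.cons 1 χ : Fin (n + 1) → A) : MvPolynomial (Fin (n + 1)) K →ₐ[K] A) := by
    ext i
    refine Fin.cases ?_ (fun j => ?_) i <;> simp [dehomogenize]
  exact DFunLike.congr_fun h F

theorem cons_one_div_mul {L : Type*} [Field L] (p : Fin (n + 1) → L) (h : p 0 ≠ 0) :
    (fun i => (Fin.cons 1 (fun j : Fin n => p j.succ / p 0) : Fin (n + 1) → L) i * p 0) = p := by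
  ext i
  refine Fin.cases ?_ (fun j => ?_) i <;> simp [h]

theorem dehomogenize_ne_zero {F : MvPolynomial (Fin (n + 1)) K} {k : ℕ} (hF : F.IsHomogeneous k)
    (h0 : F ≠ 0) : dehomogenize F ≠ 0 := by
  intro h
  let ι := algebraMap (MvPolynomial (Fin (n + 1)) K) (FractionRing (MvPolynomial (Fin (n + 1)) K))
  have hι : Function.Injective ι := IsFractionRing.injective _ _
  let p : Fin (n + 1) → FractionRing (MvPolynomial (Fin (n + 1)) K) := fun i => ι (X i)
  have hp : p 0 ≠ 0 := (map_ne_zero_iff ι hι).2 (X_ne_zero 0)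
  have h1 := aeval_mul_of_isHomogeneous hF
    (Fin.cons 1 (fun j : Fin n => p j.succ / p 0) : Fin (n + 1) → _) (p 0)
  rw [cons_one_div_mul p hp, ← aeval_dehomogenize, h, map_zero, zero_mul] at h1
  have h2 : aeval p F = ι F := by
    rw [show p = ι ∘ X from rfl, aeval_algebraMap_apply, aeval_X_left_apply]
  rw [h2] at h1
  exact h0 (hι (h1.trans (map_zero ι).symm))

/-- The homogenization of degree `N` of a polynomial of degree at most `N`, with the first
variable as the homogenizing one. -/
def homogenizeTo (N : ℕ) (c : MvPolynomial (Fin n) K) :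
    MvPolynomial (Fin (n + 1)) K :=
  ∑ k ∈ Finset.range (N + 1), rename Fin.succ (homogeneousComponent k c) * X 0 ^ (N - k)

theorem isHomogeneous_homogenizeTo (N : ℕ) (c : MvPolynomial (Fin n) K) :
    (homogenizeTo N c).IsHomogeneous N := by
  refine IsHomogeneous.sum _ _ _ fun k hk => ?_
  have h := ((homogeneousComponent_isHomogeneous k c).rename_isHomogeneous (f := Fin.succ)).mul
    (isHomogeneous_X_pow (R := K) (0 : Fin (n + 1)) (N - k))
  rwa [Nat.add_sub_cancel' (Nat.lt_succ_iff.1 (Finset.mem_range.1 hk))] at h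

theorem dehomogenize_homogenizeTo {N : ℕ} {c : MvPolynomial (Fin n) K} (hc : c.totalDegree ≤ N) :
    dehomogenize (homogenizeTo N c) = c := by
  have h : ∀ q : MvPolynomial (Fin n) K, dehomogenize (rename Fin.succ q) = q := by
    intro q
    have : (Fin.cons 1 X : Fin (n + 1) → MvPolynomial (Fin n) K) ∘ Fin.succ = X := by
      ext1 i; simp
    rw [dehomogenize, aeval_rename, this, aeval_X_left_apply]
  have h0 : dehomogenize (X 0 : MvPolynomial (Fin (n + 1)) K) = 1 := by simp [dehomogenize]
  simp only [homogenizeTo, map_sum, map_mul, map_pow, h, h0, one_pow, mul_one]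
  conv_rhs => rw [← sum_homogeneousComponent c]
  refine (Finset.sum_subset (Finset.range_mono (by omega)) fun k _ hk => ?_).symm
  exact homogeneousComponent_eq_zero _ _ (by simpa using hk)

end Dehomogenization

section Cone

variable {K L : Type*} [Field K] [Field L] [Algebra K L] {n : ℕ}

/-- The tuple `(r, r χ₁, …, r χₙ)`. -/
def coneTuple (χ : Fin n → L) (r : L) : Fin (n + 1) → L :=
  fun i => (Fin.cons 1 χ : Fin (n + 1) → L) i * r

theorem coneTuple_zero (χ : Fin n → L) (r : L) : coneTuple χ r 0 = r := by simp [coneTuple]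

theorem coneTuple_succ (χ : Fin n → L) (r : L) (i : Fin n) :
    coneTuple χ r i.succ = χ i * r := by simp [coneTuple]

theorem aeval_coneTuple_of_isHomogeneous {F : MvPolynomial (Fin (n + 1)) K} {k : ℕ}
    (hF : F.IsHomogeneous k) (χ : Fin n → L) (r : L) :
    aeval (coneTuple χ r) F = aeval χ (dehomogenize F) * r ^ k := by
  rw [aeval_dehomogenize]
  exact aeval_mul_of_isHomogeneous hF _ _

variable {F : MvPolynomial (Fin (n + 1)) K} {χ : Fin n → L} {r : L}

/-- A polynomial relation of degree `e` for `r` over `K[χ]` bounds the difference of the degree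
and the order of an equation of the ideal of relations between `r, r χ₁, …, r χₙ`. -/
theorem natDegree_sub_natTrailingDegree_le (hF : ∀ g, aeval (coneTuple χ r) g = 0 ↔ F ∣ g)
    {Q : Polynomial (MvPolynomial (Fin n) K)} (hQ : Q ≠ 0)
    (hr : Q.eval₂ (aeval χ : MvPolynomial (Fin n) K →ₐ[K] L).toRingHom r = 0) :
    (gradingPoly F).natDegree - (gradingPoly F).natTrailingDegree ≤ Q.natDegree := by
  classical
  obtain ⟨N, hN⟩ : ∃ N, ∀ i, (Q.coeff i).totalDegree ≤ N := by
    refine ⟨Q.support.sup fun i => (Q.coeff i).totalDegree, fun i => ?_⟩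
    by_cases h : i ∈ Q.support
    · exact Finset.le_sup (f := fun i => (Q.coeff i).totalDegree) h
    · simp [Polynomial.notMem_support_iff.1 h]
  let R : MvPolynomial (Fin (n + 1)) K :=
    ∑ i ∈ Finset.range (Q.natDegree + 1), homogenizeTo (N + i) (Q.coeff i)
  have hdeh : ∀ i, dehomogenize (homogenizeTo (N + i) (Q.coeff i)) = Q.coeff i := fun i =>
    dehomogenize_homogenizeTo ((hN i).trans (Nat.le_add_right _ _))
  have hR : aeval (coneTuple χ r) R = 0 := by
    have h1 : aeval (coneTuple χ r) R = r ^ N *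
        Q.eval₂ (aeval χ : MvPolynomial (Fin n) K →ₐ[K] L).toRingHom r := by
      rw [map_sum, Polynomial.eval₂_eq_sum_range, Finset.mul_sum]
      refine Finset.sum_congr rfl fun i _ => ?_
      rw [aeval_coneTuple_of_isHomogeneous (isHomogeneous_homogenizeTo _ _), hdeh, pow_add]
      simp only [AlgHom.toRingHom_eq_coe, RingHom.coe_coe]
      ring
    rw [h1, hr, mul_zero]
  have hcoeff : ∀ k, (gradingPoly R).coeff k = ∑ i ∈ Finset.range (Q.natDegree + 1),
      if k = N + i then homogenizeTo (N + i) (Q.coeff i) else 0 := by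
    intro k
    rw [map_sum, Polynomial.finsetSum_coeff]
    refine Finset.sum_congr rfl fun i _ => ?_
    rw [gradingPoly_of_isHomogeneous (isHomogeneous_homogenizeTo _ _),
      Polynomial.coeff_C_mul_X_pow]
  have hR0 : gradingPoly R ≠ 0 := by
    intro h
    have h2 := hcoeff (N + Q.natDegree)
    rw [Finset.sum_eq_single Q.natDegree, if_pos rfl, h, Polynomial.coeff_zero] at h2
    · have h3 := hdeh Q.natDegree
      rw [← h2, map_zero] at h3
      exact hQ (Polynomial.leadingCoeff_eq_zero.1 h3.symm)
    · intro i _ hi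
      exact if_neg fun h => hi (by omega)
    · intro h; simp at h
  have hle : (gradingPoly R).natDegree ≤ N + Q.natDegree := by
    refine Polynomial.natDegree_le_iff_coeff_eq_zero.2 fun k hk => ?_
    rw [hcoeff]
    refine Finset.sum_eq_zero fun i hi => if_neg fun h => ?_
    have := Finset.mem_range.1 hi
    omega
  have hge : N ≤ (gradingPoly R).natTrailingDegree := by
    refine Polynomial.le_natTrailingDegree hR0 fun k hk => ?_
    rw [hcoeff]
    exact Finset.sum_eq_zero fun i hi => if_neg fun h => by omega
  obtain ⟨S, hS⟩ := (hF R).1 hR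
  rw [hS, map_mul] at hR0 hle hge
  have h1 := left_ne_zero_of_mul hR0
  have h2 := right_ne_zero_of_mul hR0
  rw [Polynomial.natDegree_mul h1 h2] at hle
  rw [Polynomial.natTrailingDegree_mul h1 h2] at hge
  have := Polynomial.natTrailingDegree_le_natDegree (gradingPoly S)
  omega

theorem aeval_dehomogenize_ne_zero (hχ : AlgebraicIndependent K χ)
    {G : MvPolynomial (Fin (n + 1)) K} {k : ℕ} (hG : G.IsHomogeneous k) (h0 : G ≠ 0) :
    aeval χ (dehomogenize G) ≠ 0 := fun h =>
  dehomogenize_ne_zero hG h0 ((algebraicIndependent_iff.1 hχ) _ h)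

/-- The tuple `χ` is algebraically independent if and only if the equation `F` of the relations
between `r, r χ₁, …, r χₙ` is not homogeneous, that is, does not define a cone. -/
theorem algebraicIndependent_iff_natTrailingDegree_lt (hF0 : F ≠ 0) (hr : r ≠ 0)
    (hF : ∀ g, aeval (coneTuple χ r) g = 0 ↔ F ∣ g) :
    AlgebraicIndependent K χ ↔
      (gradingPoly F).natTrailingDegree < (gradingPoly F).natDegree := by
  constructor
  · intro hχ
    by_contra hlt
    have h0 : aeval (coneTuple χ r) F = 0 := (hF F).2 dvd_rfl
    have hh := isHomogeneous_of_natDegree_le (not_lt.1 hlt)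
    rw [aeval_coneTuple_of_isHomogeneous hh] at h0
    exact (mul_ne_zero (aeval_dehomogenize_ne_zero hχ hh hF0) (pow_ne_zero _ hr)) h0
  · intro hlt
    rw [algebraicIndependent_iff]
    intro c hc
    by_contra hc0
    have := natDegree_sub_natTrailingDegree_le hF (Q := Polynomial.C c) (by simpa using hc0)
      (by simpa using hc)
    rw [Polynomial.natDegree_C] at this
    omega

open scoped IntermediateField.algebraAdjoinAdjoin in
/-- An element satisfying a polynomial relation over `K(χ)` satisfies one over `K[χ]` of no larger
degree. -/
theorem exists_eval₂_eq_zero_of_aeval_eq_zero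
    {P : Polynomial (IntermediateField.adjoin K (Set.range χ))} (hP : P ≠ 0)
    (hχ : AlgebraicIndependent K χ) (hr : Polynomial.aeval r P = 0) :
    ∃ Q : Polynomial (MvPolynomial (Fin n) K), Q ≠ 0 ∧ Q.natDegree ≤ P.natDegree ∧
      Q.eval₂ (aeval χ : MvPolynomial (Fin n) K →ₐ[K] L).toRingHom r = 0 := by
  let A := Algebra.adjoin K (Set.range χ)
  let P' : Polynomial A := IsLocalization.integerNormalization (nonZeroDivisors A) P
  have hP' : P' ≠ 0 := fun h => hP (IsFractionRing.integerNormalization_eq_zero_iff.1 h)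
  have hr' : Polynomial.aeval r P' = 0 :=
    IsLocalization.integerNormalization_aeval_eq_zero _ P hr
  have he : Function.Injective hχ.aevalEquiv.symm.toRingEquiv.toRingHom :=
    hχ.aevalEquiv.symm.injective
  refine ⟨P'.map hχ.aevalEquiv.symm.toRingEquiv.toRingHom, ?_, ?_, ?_⟩
  · exact (Polynomial.map_ne_zero_iff he).2 hP'
  · rw [Polynomial.natDegree_map_eq_of_injective he]
    refine Polynomial.natDegree_le_iff_coeff_eq_zero.2 fun k hk => ?_
    by_contra h
    have h1 := IsLocalization.integerNormalization_support (nonZeroDivisors A) P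
      (Polynomial.mem_support_iff.2 h)
    exact Polynomial.mem_support_iff.1 h1 (Polynomial.coeff_eq_zero_of_natDegree_lt hk)
  · rw [Polynomial.eval₂_map, ← hr', Polynomial.aeval_def]
    congr 1
    ext1 x
    obtain ⟨g, rfl⟩ := hχ.aevalEquiv.surjective x
    simp [A]

theorem natDegree_minpoly_coneTuple (hF0 : F ≠ 0) (hr : r ≠ 0)
    (hF : ∀ g, aeval (coneTuple χ r) g = 0 ↔ F ∣ g) (hχ : AlgebraicIndependent K χ) :
    IsIntegral (IntermediateField.adjoin K (Set.range χ)) r ∧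
    (minpoly (IntermediateField.adjoin K (Set.range χ)) r).natDegree =
      (gradingPoly F).natDegree - (gradingPoly F).natTrailingDegree := by
  let M := IntermediateField.adjoin K (Set.range χ)
  let χ' : Fin n → M := fun i => ⟨χ i, IntermediateField.subset_adjoin _ _ ⟨i, rfl⟩⟩
  have hχ' : ∀ g : MvPolynomial (Fin n) K, M.val (aeval χ' g) = aeval χ g := by
    have h : M.val.comp (aeval χ') = (aeval χ : MvPolynomial (Fin n) K →ₐ[K] L) := by
      ext i; simp [χ']
    exact DFunLike.congr_fun h
  let ψ : MvPolynomial (Fin (n + 1)) K →ₐ[K] M := aeval (Fin.cons 1 χ')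
  have hψ : ∀ g, ψ g = aeval χ' (dehomogenize g) := fun g => (aeval_dehomogenize _ _).symm
  have hψ0 : ∀ k, (gradingPoly F).coeff k ≠ 0 → ψ ((gradingPoly F).coeff k) ≠ 0 := by
    intro k hk h
    rw [coeff_gradingPoly] at hk h
    rw [hψ] at h
    refine aeval_dehomogenize_ne_zero hχ (homogeneousComponent_isHomogeneous k F) hk ?_
    rw [← hχ', h, map_zero]
  let W : Polynomial M := (gradingPoly F).map ψ.toRingHom
  have hW : ∀ k, W.coeff k = ψ ((gradingPoly F).coeff k) := fun k => Polynomial.coeff_map _ _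
  have hWr : Polynomial.aeval r W = 0 := by
    have h0 : aeval (fun i => (Fin.cons 1 χ : Fin (n + 1) → L) i * r) F = 0 := (hF F).2 dvd_rfl
    rw [Polynomial.aeval_def, Polynomial.eval₂_map, ← h0, ← eval₂_gradingPoly]
    congr 1
    refine MvPolynomial.ringHom_ext (fun c => ?_) fun i => ?_
    · simp [ψ, ← IsScalarTower.algebraMap_apply]
    · refine Fin.cases ?_ (fun j => ?_) i <;> simp [ψ, χ']
  set m := (gradingPoly F).natTrailingDegree
  set d := (gradingPoly F).natDegree
  have hmd : m ≤ d := Polynomial.natTrailingDegree_le_natDegree _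
  obtain ⟨V, hV⟩ : Polynomial.X ^ m ∣ W := by
    refine Polynomial.X_pow_dvd_iff.2 fun k hk => ?_
    rw [hW, Polynomial.coeff_eq_zero_of_lt_natTrailingDegree hk, map_zero]
  have hWd : W.natDegree = d := by
    refine Polynomial.natDegree_map_of_leadingCoeff_ne_zero _ (hψ0 _ ?_)
    exact Polynomial.leadingCoeff_ne_zero.2 (gradingPoly_ne_zero hF0)
  have hW0 : W ≠ 0 := by
    intro h
    have := hW d
    rw [h, Polynomial.coeff_zero] at this
    exact hψ0 d (Polynomial.leadingCoeff_ne_zero.2 (gradingPoly_ne_zero hF0)) this.symm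
  have hV0 : V ≠ 0 := by rintro rfl; exact hW0 (by rw [hV, mul_zero])
  have hVd : V.natDegree = d - m := by
    have := Polynomial.natDegree_mul (pow_ne_zero m Polynomial.X_ne_zero) hV0
    rw [← hV, hWd, Polynomial.natDegree_X_pow] at this
    omega
  have hVr : Polynomial.aeval r V = 0 := by
    rw [hV, map_mul, map_pow, Polynomial.aeval_X] at hWr
    exact (mul_eq_zero.1 hWr).resolve_left (pow_ne_zero _ hr)
  have hint : IsIntegral M r := isAlgebraic_iff_isIntegral.1 ⟨V, hV0, hVr⟩
  refine ⟨hint, le_antisymm ?_ ?_⟩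
  · rw [← hVd]
    exact Polynomial.natDegree_le_of_dvd (minpoly.dvd _ _ hVr) hV0
  · obtain ⟨Q, hQ0, hQd, hQr⟩ :=
      exists_eval₂_eq_zero_of_aeval_eq_zero (minpoly.ne_zero hint) hχ (minpoly.aeval M r)
    exact (natDegree_sub_natTrailingDegree_le hF hQ0 hQr).trans hQd

theorem finrank_adjoin_eq_mul (hF0 : F ≠ 0) (hr : r ≠ 0)
    (hF : ∀ g, aeval (coneTuple χ r) g = 0 ↔ F ∣ g) (hχ : AlgebraicIndependent K χ) :
    Module.finrank (IntermediateField.adjoin K (Set.range χ)) L =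
      ((gradingPoly F).natDegree - (gradingPoly F).natTrailingDegree) *
        Module.finrank (IntermediateField.adjoin K (Set.range (coneTuple χ r))) L := by
  let M := IntermediateField.adjoin K (Set.range χ)
  obtain ⟨hint, hdeg⟩ := natDegree_minpoly_coneTuple hF0 hr hF hχ
  have h : IntermediateField.adjoin K (Set.range (coneTuple χ r)) =
      (IntermediateField.adjoin M {r}).restrictScalars K := by
    rw [IntermediateField.adjoin_adjoin_left]
    apply le_antisymm
    · rw [IntermediateField.adjoin_le_iff]
      rintro _ ⟨i, rfl⟩
      have h1 : r ∈ IntermediateField.adjoin K (Set.range χ ∪ {r}) :=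
        IntermediateField.subset_adjoin _ _ (by simp)
      refine Fin.cases ?_ (fun j => ?_) i
      · rwa [coneTuple_zero]
      · rw [coneTuple_succ]
        exact mul_mem (IntermediateField.subset_adjoin _ _ (by simp)) h1
    · rw [IntermediateField.adjoin_le_iff]
      have h1 : r ∈ IntermediateField.adjoin K (Set.range (coneTuple χ r)) :=
        IntermediateField.subset_adjoin _ _ ⟨0, coneTuple_zero _ _⟩
      rintro _ (⟨i, rfl⟩ | rfl)
      · have h2 : coneTuple χ r i.succ ∈ IntermediateField.adjoin K (Set.range (coneTuple χ r)) :=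
          IntermediateField.subset_adjoin _ _ ⟨_, rfl⟩
        rw [coneTuple_succ] at h2
        have := div_mem h2 h1
        rwa [mul_div_cancel_right₀ _ hr] at this
      · exact h1
  rw [h, ← hdeg, ← IntermediateField.adjoin.finrank hint]
  exact (Module.finrank_mul_finrank M (IntermediateField.adjoin M {r}) L).symm

end Cone

section Specialization

/-- Evaluating a polynomial at fractions `aᵢ/bᵢ`, a power of `∏ bᵢ` clears the denominators,
uniformly in the homomorphism to a field along which the fractions are formed. -/
theorem exists_clear_denominators.{v} {σ K R : Type*} [Fintype σ] [Field K] [CommRing R]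
    [Algebra K R] (a b : σ → R) (g : MvPolynomial σ K) :
    ∃ (u : R) (N : ℕ), ∀ (E : Type v) [Field E] [Algebra K E] (φ : R →ₐ[K] E),
      (∀ i, φ (b i) ≠ 0) → aeval (fun i => φ (a i) / φ (b i)) g * φ (∏ i, b i) ^ N = φ u := by
  classical
  induction g using MvPolynomial.induction_on with
  | C c => exact ⟨algebraMap K R c, 0, fun E _ _ φ _ => by simp⟩
  | add p q hp hq =>
    obtain ⟨u, N, hu⟩ := hp
    obtain ⟨u', N', hu'⟩ := hq
    refine ⟨u * (∏ i, b i) ^ N' + u' * (∏ i, b i) ^ N, N + N', fun E _ _ φ hφ => ?_⟩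
    rw [map_add, map_add, map_mul, map_mul, ← hu E φ hφ, ← hu' E φ hφ, map_pow, map_pow]
    ring
  | mul_X p i hp =>
    obtain ⟨u, N, hu⟩ := hp
    refine ⟨u * (a i * ∏ j ∈ Finset.univ.erase i, b j), N + 1, fun E _ _ φ hφ => ?_⟩
    have h : φ (∏ j, b j) = φ (b i) * φ (∏ j ∈ Finset.univ.erase i, b j) := by
      rw [← map_mul, Finset.mul_prod_erase _ _ (Finset.mem_univ i)]
    rw [map_mul, map_mul, map_mul, ← hu E φ hφ, aeval_X, pow_succ]
    conv_lhs => rw [mul_assoc, mul_left_comm _ _ (φ _), ← mul_assoc]; arg 2; rw [h]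
    field_simp [hφ i]

/-- A polynomial relation between fractions persists under every homomorphism to a field that
does not annihilate the denominators. -/
theorem aeval_div_eq_zero_of_aeval_div_eq_zero.{v} {σ K R : Type*} {Q E : Type v} [Fintype σ]
    [Field K] [CommRing R] [Algebra K R] [Field Q] [Algebra K Q] [Field E] [Algebra K E]
    {a b : σ → R} {g : MvPolynomial σ K} {ι : R →ₐ[K] Q} (hι : Function.Injective ι)
    (hb : ∀ i, b i ≠ 0) (h : aeval (fun i => ι (a i) / ι (b i)) g = 0) (φ : R →ₐ[K] E)
    (hφ : ∀ i, φ (b i) ≠ 0) : aeval (fun i => φ (a i) / φ (b i)) g = 0 := by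
  obtain ⟨u, N, hu⟩ := exists_clear_denominators.{v} a b g
  have h1 := hu Q ι fun i => (map_ne_zero_iff ι hι).2 (hb i)
  rw [h, zero_mul] at h1
  have h2 := hu E φ hφ
  rw [hι (h1.symm.trans (map_zero ι).symm), map_zero] at h2
  refine (mul_eq_zero.1 h2).resolve_right (pow_ne_zero _ ?_)
  rw [map_prod]
  exact Finset.prod_ne_zero_iff.2 fun i _ => hφ i

theorem aeval_cons_eq_eval₂_finSuccEquiv {K L : Type*} [Field K] [CommRing L] [Algebra K L] {n : ℕ}
    (y : L) (x : Fin n → L) (g : MvPolynomial (Fin (n + 1)) K) :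
    aeval (Fin.cons y x : Fin (n + 1) → L) g =
      (finSuccEquiv K n g).eval₂ (aeval x : MvPolynomial (Fin n) K →ₐ[K] L).toRingHom y := by
  induction g using MvPolynomial.induction_on with
  | C c => simp [finSuccEquiv_apply]
  | add p q hp hq => rw [map_add, map_add, Polynomial.eval₂_add, hp, hq]
  | mul_X p i hp =>
    rw [map_mul, map_mul, Polynomial.eval₂_mul, hp, aeval_X]
    refine Fin.cases ?_ (fun j => ?_) i <;> simp [finSuccEquiv_X_zero, finSuccEquiv_X_succ]

/-- Let `σ` be a retraction of the `R`-algebra `B` to `R` that factors through the image of `ψ`. An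
element of the image that is algebraic over `R` and vanishes under `σ` is zero; here the element
may be a fraction with denominator prime to `σ`. -/
theorem eq_zero_of_isAlgebraic_div {R B E : Type*} [CommRing R] [IsDomain R] [CommRing B]
    [Algebra R B] [Field E] [Algebra R E] (ψ : B →ₐ[R] E) (σ : B →ₐ[R] R)
    (hσ : ∀ x, ψ x = 0 → σ x = 0) {u v : B} (hu : σ u = 0) (hv : σ v ≠ 0)
    (h : IsAlgebraic R (ψ u / ψ v)) : ψ u = 0 := by
  by_contra hψ
  have hψv : ψ v ≠ 0 := fun h0 => hv (hσ v h0)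
  obtain ⟨p, hp0, hp⟩ := h.exists_nonzero_coeff_and_aeval_eq_zero
    (mem_nonZeroDivisors_of_ne_zero (div_ne_zero hψ hψv))
  let n := p.natDegree
  have h1 : ψ (∑ i ∈ Finset.range (n + 1), algebraMap R B (p.coeff i) * u ^ i * v ^ (n - i)) =
      ψ v ^ n * Polynomial.aeval (ψ u / ψ v) p := by
    rw [Polynomial.aeval_eq_sum_range, map_sum, Finset.mul_sum]
    refine Finset.sum_congr rfl fun i hi => ?_
    obtain ⟨k, hk : n = i + k⟩ := Nat.exists_eq_add_of_le (Nat.lt_succ_iff.1 (Finset.mem_range.1 hi))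
    rw [hk, Nat.add_sub_cancel_left, Algebra.smul_def, pow_add, div_pow]
    simp only [map_mul, map_pow, AlgHom.commutes]
    field_simp
  rw [hp, mul_zero] at h1
  have h2 := hσ _ h1
  rw [map_sum, Finset.sum_eq_single 0] at h2
  · simp only [map_mul, map_pow, AlgHom.commutes, pow_zero, Nat.sub_zero, mul_one] at h2
    exact mul_ne_zero hp0 (pow_ne_zero _ hv) h2
  · intro i _ hi
    simp [hu, hi]
  · intro h; simp at h

end Specialization

section Diagonal

variable {K : Type*} [Field K]

variable (K) in
/-- Restriction to the diagonal `(t, s) = (h₁, h₂)`. -/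
def diagonal : Poly4 K →ₐ[Poly2 K] Poly2 K := aeval X

theorem diagonal_map_C (a : Poly2 K) : diagonal K (map C a) = a := by
  exact (aeval_map_algebraMap (Poly2 K) X a).trans (aeval_X_left_apply a)

theorem diagonal_C (a : Poly2 K) : diagonal K (C a) = a := (diagonal K).commutes a

/-- The polynomial `a(t, s) b(h₁, h₂) - a(h₁, h₂) b(t, s)`. -/
def crossDiff (a b : Poly2 K) : Poly4 K := map C a * C b - C a * map C b

theorem map_C_injective : Function.Injective (map C : Poly2 K → Poly4 K) :=
  map_injective _ (C_injective _ _)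

theorem exists_den_mul_eq_num_mul_eq {R F : Type*} [CommRing R] [IsDomain R]
    [UniqueFactorizationMonoid R] [Field F] [Algebra R F] [IsFractionRing R F] {n m : R}
    {δ : F} (hδ : δ * algebraMap R F m = algebraMap R F n) :
    ∃ d e : R, d * e = m ∧ IsFractionRing.num R δ * e = n := by
  have hι : Function.Injective (algebraMap R F) := IsFractionRing.injective _ _
  let d : R := IsFractionRing.den R δ
  have hd : d ≠ 0 := nonZeroDivisors.ne_zero (IsFractionRing.den R δ).2
  have hnd : algebraMap R F (IsFractionRing.num R δ) = δ * algebraMap R F d := by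
    rw [← div_eq_iff ((map_ne_zero_iff _ hι).2 hd)]
    exact IsFractionRing.mk'_num_den' R δ
  have h1 : IsFractionRing.num R δ * m = d * n := by
    apply hι
    rw [map_mul, map_mul, hnd, ← hδ]
    ring
  have h2 : IsRelPrime d (IsFractionRing.num R δ) := (IsFractionRing.num_den_reduced R δ).symm
  obtain ⟨e, he⟩ := h2.dvd_of_dvd_mul_left (h1 ▸ dvd_mul_right d _)
  refine ⟨d, e, he.symm, mul_left_cancel₀ hd ?_⟩
  rw [← h1, he]
  ring

theorem inTS_algebraMap (x : Poly2 K) :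
    inTS K (algebraMap (Poly2 K) (Rat2 K) x) = algebraMap (Poly4 K) (Rat4 K) (map C x) := by
  rw [inTS, IsFractionRing.map]; exact IsLocalization.map_eq _ x

theorem inH_algebraMap (x : Poly2 K) :
    inH K (algebraMap (Poly2 K) (Rat2 K) x) = algebraMap (Poly4 K) (Rat4 K) (C x) := by
  rw [inH, IsFractionRing.map]; exact IsLocalization.map_eq _ x

theorem exists_diffNumer_mul_eq {a b : Poly2 K} (hb : b ≠ 0) :
    ∃ d e : Poly4 K, d * e = map C b * C b ∧
      diffNumer (algebraMap (Poly2 K) (Rat2 K) a / algebraMap (Poly2 K) (Rat2 K) b) * e =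
        crossDiff a b := by
  have hι : Function.Injective (algebraMap (Poly4 K) (Rat4 K)) := IsFractionRing.injective _ _
  have hb1 : (map C b : Poly4 K) ≠ 0 := (map_ne_zero_iff _ map_C_injective).2 hb
  have hb2 : (C b : Poly4 K) ≠ 0 := (map_ne_zero_iff _ (C_injective _ _)).2 hb
  refine exists_den_mul_eq_num_mul_eq ?_
  have hb1' := (map_ne_zero_iff _ hι).2 hb1
  have hb2' := (map_ne_zero_iff _ hι).2 hb2
  rw [map_div₀, map_div₀, inTS_algebraMap, inTS_algebraMap, inH_algebraMap, inH_algebraMap,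
    crossDiff, map_sub, map_mul, map_mul, map_mul]
  generalize algebraMap (Poly4 K) (Rat4 K) (map C b) = x at *
  generalize algebraMap (Poly4 K) (Rat4 K) (C b) = y at *
  field_simp

/-- A prime of `K[h₁, h₂][t, s]` that vanishes on the diagonal divides the numerator of
`χ(t, s) - χ(h₁, h₂)` if and only if it divides the cross difference. -/
theorem dvd_diffNumer_iff {a b : Poly2 K} (hb : b ≠ 0) {q : Poly4 K} (hq : Prime q)
    (hdiag : diagonal K q = 0) :
    q ∣ diffNumer (algebraMap (Poly2 K) (Rat2 K) a / algebraMap (Poly2 K) (Rat2 K) b) ↔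
      q ∣ crossDiff a b := by
  obtain ⟨d, e, hde, he⟩ := exists_diffNumer_mul_eq (a := a) hb
  rw [← he]
  refine ⟨fun h => h.mul_right e, fun h => (hq.dvd_or_dvd h).resolve_right fun hqe => ?_⟩
  have h1 : q ∣ map C b * C b := hde ▸ hqe.mul_left d
  have h2 := map_dvd (diagonal K) h1
  rw [hdiag, zero_dvd_iff, map_mul, diagonal_map_C, diagonal_C] at h2
  exact mul_ne_zero hb hb h2

theorem dvd_crossDiff_of_dvd_diffNumer {a b : Poly2 K} (hb : b ≠ 0) {q : Poly4 K}
    (h : q ∣ diffNumer (algebraMap (Poly2 K) (Rat2 K) a / algebraMap (Poly2 K) (Rat2 K) b)) :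
    q ∣ crossDiff a b := by
  obtain ⟨d, e, -, he⟩ := exists_diffNumer_mul_eq (a := a) hb
  exact he ▸ h.mul_right e

theorem diagonal_diffNumer {a b : Poly2 K} (hb : b ≠ 0) :
    diagonal K (diffNumer (algebraMap (Poly2 K) (Rat2 K) a / algebraMap (Poly2 K) (Rat2 K) b)) =
      0 := by
  obtain ⟨d, e, hde, he⟩ := exists_diffNumer_mul_eq (a := a) hb
  have h1 := congrArg (diagonal K) he
  have h2 := congrArg (diagonal K) hde
  rw [map_mul, crossDiff, map_sub, map_mul, map_mul, diagonal_map_C, diagonal_C, diagonal_C,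
    diagonal_map_C, sub_self] at h1
  rw [map_mul, map_mul, diagonal_map_C, diagonal_C] at h2
  refine (mul_eq_zero.1 h1).resolve_right fun h => ?_
  rw [h, mul_zero] at h2
  exact mul_ne_zero hb hb h2.symm

/-- A nonzero polynomial vanishing on the diagonal has a prime factor vanishing there. -/
theorem exists_prime_dvd_diagonal_eq_zero {g : Poly4 K} (hg : g ≠ 0) (h : diagonal K g = 0) :
    ∃ q, Prime q ∧ q ∣ g ∧ diagonal K q = 0 := by
  obtain ⟨s, hs, hsg⟩ := UniqueFactorizationMonoid.exists_prime_factors g hg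
  have h1 : diagonal K s.prod = 0 := by
    have := map_dvd (diagonal K) hsg.symm.dvd
    rwa [h, zero_dvd_iff] at this
  rw [map_multiset_prod, Multiset.prod_eq_zero_iff, Multiset.mem_map] at h1
  obtain ⟨q, hqs, hq⟩ := h1
  exact ⟨q, hs q hqs, (Multiset.dvd_prod hqs).trans hsg.dvd, hq⟩

end Diagonal

section Transcendence

variable {K : Type*} [Field K]

theorem isTranscendenceBasis_X (K : Type*) [Field K] (σ : Type*) :
    IsTranscendenceBasis K (X : σ → MvPolynomial σ K) := by
  refine (isTranscendenceBasis_iff_algebraicIndependent_isAlgebraic).2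
    ⟨algebraicIndependent_X σ K, ⟨fun a => ?_⟩⟩
  have h : a ∈ Algebra.adjoin K (Set.range (X : σ → MvPolynomial σ K)) := by
    rw [adjoin_range_X]; exact Algebra.mem_top
  exact isAlgebraic_algebraMap (⟨a, h⟩ : Algebra.adjoin K (Set.range X))

theorem trdeg_Rat2 : Algebra.trdeg K (Rat2 K) = 2 := by
  have : Algebra.IsAlgebraic (Poly2 K) (Rat2 K) :=
    IsLocalization.isAlgebraic _ (nonZeroDivisors (Poly2 K))
  have h :=
    ((isTranscendenceBasis_X K (Fin 2)).algebraMap_comp (A := Rat2 K)).lift_cardinalMk_eq_trdeg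
  simpa using h.symm

theorem isAlgebraic_adjoin_of_algebraicIndependent {χ : Fin 2 → Rat2 K}
    (hχ : AlgebraicIndependent K χ) :
    Algebra.IsAlgebraic (IntermediateField.adjoin K (Set.range χ)) (Rat2 K) := by
  have h1 : IsTranscendenceBasis K χ := by
    refine hχ.isTranscendenceBasis_of_lift_trdeg_le_of_finite ?_
    rw [trdeg_Rat2]; simp
  have := h1.isAlgebraic_field
  exact this

/-- The rational function field is finite over the field generated by two algebraically
independent elements. -/
theorem finiteDimensional_adjoin_of_algebraicIndependent {χ : Fin 2 → Rat2 K}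
    (hχ : AlgebraicIndependent K χ) :
    FiniteDimensional (IntermediateField.adjoin K (Set.range χ)) (Rat2 K) := by
  have := isAlgebraic_adjoin_of_algebraicIndependent hχ
  let M := IntermediateField.adjoin K (Set.range χ)
  let S : Set (Rat2 K) := Set.range fun i => algebraMap (Poly2 K) (Rat2 K) (X i)
  have hS : IntermediateField.adjoin M S = ⊤ := by
    rw [eq_top_iff]
    intro x _
    have hp : ∀ p : Poly2 K, algebraMap (Poly2 K) (Rat2 K) p ∈ IntermediateField.adjoin M S := by
      intro p
      induction p using MvPolynomial.induction_on with
      | C c =>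
        have : algebraMap (Poly2 K) (Rat2 K) (C c) = algebraMap M (Rat2 K) (algebraMap K M c) := by
          rw [← IsScalarTower.algebraMap_apply K M, IsScalarTower.algebraMap_apply K (Poly2 K)]
          rfl
        rw [this]
        exact IntermediateField.algebraMap_mem _ _
      | add p q hp hq => rw [map_add]; exact add_mem hp hq
      | mul_X p i hp =>
        rw [map_mul]; exact mul_mem hp (IntermediateField.subset_adjoin _ _ ⟨i, rfl⟩)
    obtain ⟨a, b, -, rfl⟩ := IsFractionRing.div_surjective (A := Poly2 K) x
    exact div_mem (hp a) (hp b)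
  have h1 : FiniteDimensional M (IntermediateField.adjoin M S) :=
    IntermediateField.finiteDimensional_adjoin fun x _ => Algebra.IsIntegral.isIntegral x
  rw [hS] at h1
  exact Module.Finite.equiv (IntermediateField.topEquiv (F := M) (E := Rat2 K)).toLinearEquiv

theorem exists_aeval_cons_eq_zero {χ : Fin 2 → Rat2 K} (hχ : AlgebraicIndependent K χ)
    (y : Rat2 K) :
    ∃ g : MvPolynomial (Fin 3) K, g ≠ 0 ∧ aeval (Fin.cons y χ : Fin 3 → Rat2 K) g = 0 := by
  have := isAlgebraic_adjoin_of_algebraicIndependent hχ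
  obtain ⟨P, hP, hy⟩ := Algebra.IsAlgebraic.isAlgebraic
    (R := IntermediateField.adjoin K (Set.range χ)) y
  obtain ⟨Q, hQ, -, hQy⟩ := exists_eval₂_eq_zero_of_aeval_eq_zero hP hχ hy
  refine ⟨(finSuccEquiv K 2).symm Q, by simpa using hQ, ?_⟩
  rwa [aeval_cons_eq_eval₂_finSuccEquiv, AlgEquiv.apply_symm_apply]

end Transcendence

section Fibre

variable {K : Type*} {E : Type*} [Field K] [Field E] [Algebra (Poly2 K) E] [Algebra K E]
  [IsScalarTower K (Poly2 K) E] [FaithfulSMul (Poly2 K) E]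

variable (K E) in
/-- The extension of the inclusion of `K[h₁, h₂]` to its field of fractions. -/
def liftRat : Rat2 K →ₐ[K] E :=
  IsFractionRing.liftAlgHom (g := IsScalarTower.toAlgHom K (Poly2 K) E)
    (FaithfulSMul.algebraMap_injective (Poly2 K) E)

theorem liftRat_algebraMap (x : Poly2 K) :
    liftRat K E (algebraMap (Poly2 K) (Rat2 K) x) = algebraMap (Poly2 K) E x := by
  exact IsFractionRing.lift_algebraMap (A := Poly2 K)
    (g := (IsScalarTower.toAlgHom K (Poly2 K) E : Poly2 K →+* E))
    (FaithfulSMul.algebraMap_injective (Poly2 K) E) x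

/-- A polynomial relation `g(y, θ(x)) = 0`, where `x` is algebraically independent, makes `y`
algebraic over `K[h₁, h₂]`. -/
theorem isAlgebraic_of_aeval_cons_eq_zero {n : ℕ} {g : MvPolynomial (Fin (n + 1)) K} (hg : g ≠ 0)
    {x : Fin n → Rat2 K} (hx : AlgebraicIndependent K x) {y : E}
    (h : aeval (Fin.cons y fun i => liftRat K E (x i) : Fin (n + 1) → E) g = 0) :
    IsAlgebraic (Poly2 K) y := by
  let P : Polynomial (Rat2 K) :=
    (finSuccEquiv K n g).map (aeval x : MvPolynomial (Fin n) K →ₐ[K] Rat2 K).toRingHom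
  have hP : P ≠ 0 := by
    refine (Polynomial.map_ne_zero_iff hx).2 ?_
    simpa using hg
  have hPy : P.eval₂ (liftRat K E).toRingHom y = 0 := by
    rw [Polynomial.eval₂_map, ← h, aeval_cons_eq_eval₂_finSuccEquiv]
    congr 1
    refine MvPolynomial.ringHom_ext (fun c => ?_) fun i => ?_ <;> simp
  refine ⟨IsLocalization.integerNormalization (nonZeroDivisors (Poly2 K)) P,
    fun h => hP (IsFractionRing.integerNormalization_eq_zero_iff.1 h), ?_⟩
  have := IsLocalization.integerNormalization_eval₂_eq_zero (M := nonZeroDivisors (Poly2 K)) _ P hPy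
  rw [Polynomial.aeval_def, ← this]
  congr 1
  refine RingHom.ext fun z => ?_
  exact (liftRat_algebraMap z).symm

end Fibre

section FibreField

variable {K : Type u} [Field K]

theorem exists_ringHom_field_apply_eq_zero_iff {B : Type u} [CommRing B] {q : B} (hq : Prime q) :
    ∃ (E : Type u) (_ : Field E) (j : B →+* E), ∀ x, j x = 0 ↔ q ∣ x := by
  have hP : (Ideal.span {q}).IsPrime := (Ideal.span_singleton_prime hq.ne_zero).2 hq
  refine ⟨FractionRing (B ⧸ Ideal.span {q}), inferInstance,
    (algebraMap (B ⧸ Ideal.span {q}) _).comp (Ideal.Quotient.mk _), fun x => ?_⟩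
  rw [RingHom.comp_apply, map_eq_zero_iff _ (IsFractionRing.injective (B ⧸ Ideal.span {q}) _),
    Ideal.Quotient.eq_zero_iff_mem, Ideal.mem_span_singleton]

/-- The function field of the hypersurface `q(t, s, h₁, h₂) = 0`. -/
theorem exists_fibre_field {q : Poly4 K} (hq : Prime q) :
    ∃ (E : Type u) (_ : Field E) (_ : Algebra (Poly2 K) E) (_ : Algebra K E)
      (_ : IsScalarTower K (Poly2 K) E) (ψ : Poly4 K →ₐ[Poly2 K] E), ∀ x, ψ x = 0 ↔ q ∣ x := by
  obtain ⟨E, _, j, hj⟩ := exists_ringHom_field_apply_eq_zero_iff hq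
  let i2 : Algebra (Poly2 K) E := (j.comp C).toAlgebra
  let i1 : Algebra K E := ((j.comp C).comp C).toAlgebra
  exact ⟨E, inferInstance, i2, i1, IsScalarTower.of_algebraMap_eq fun _ => rfl,
    { j with commutes' := fun _ => rfl }, hj⟩

variable {E : Type u} [Field E] [Algebra (Poly2 K) E] [Algebra K E] [IsScalarTower K (Poly2 K) E]

/-- The restriction to `K[t, s]` of a homomorphism of `K[h₁, h₂]`-algebras. -/
def restrictTS (ψ : Poly4 K →ₐ[Poly2 K] E) : Poly2 K →ₐ[K] E := aeval fun i => ψ (X i)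

theorem restrictTS_apply (ψ : Poly4 K →ₐ[Poly2 K] E) (x : Poly2 K) :
    restrictTS ψ x = ψ (map C x) := by
  induction x using MvPolynomial.induction_on with
  | C c =>
    rw [map_C, restrictTS, aeval_C, IsScalarTower.algebraMap_apply K (Poly2 K)]
    exact (ψ.commutes _).symm
  | add p q hp hq => simp only [map_add, hp, hq]
  | mul_X p i hp => rw [map_mul, map_mul, map_mul, hp, map_X, restrictTS, aeval_X]

theorem crossDiff_eq_zero_iff [FaithfulSMul (Poly2 K) E] (ψ : Poly4 K →ₐ[Poly2 K] E)
    {a b : Poly2 K} (hb : b ≠ 0) (hb' : restrictTS ψ b ≠ 0) :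
    ψ (crossDiff a b) = 0 ↔ restrictTS ψ a / restrictTS ψ b =
      liftRat K E (algebraMap (Poly2 K) (Rat2 K) a / algebraMap (Poly2 K) (Rat2 K) b) := by
  have hb2 : algebraMap (Poly2 K) E b ≠ 0 :=
    (map_ne_zero_iff _ (FaithfulSMul.algebraMap_injective (Poly2 K) E)).2 hb
  have hC : ∀ x : Poly2 K, ψ (C x) = algebraMap (Poly2 K) E x := ψ.commutes
  rw [map_div₀, liftRat_algebraMap, liftRat_algebraMap, crossDiff, map_sub, map_mul, map_mul,
    hC, hC, ← restrictTS_apply, ← restrictTS_apply, sub_eq_zero, div_eq_div_iff hb' hb2]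

/-- If `χ₀` and `χ₁` are dependent and `χ₁` is not constant, then a component through the diagonal
of the locus `χ₁(t, s) = χ₁(h₁, h₂)` is contained in the locus `χ₀(t, s) = χ₀(h₁, h₂)`. -/
theorem dvd_crossDiff_of_not_algebraicIndependent {a b : Fin 2 → Poly2 K} (hb : ∀ i, b i ≠ 0)
    {χ : Fin 2 → Rat2 K}
    (hχ : ∀ i, χ i = algebraMap (Poly2 K) (Rat2 K) (a i) / algebraMap (Poly2 K) (Rat2 K) (b i))
    (htr : Transcendental K (χ 1)) (hdep : ¬ AlgebraicIndependent K χ) {q : Poly4 K}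
    (hq : Prime q) (hdiag : diagonal K q = 0) (hdvd : q ∣ crossDiff (a 1) (b 1)) :
    q ∣ crossDiff (a 0) (b 0) := by
  obtain ⟨E, _, _, _, _, ψ, hψ⟩ := exists_fibre_field hq
  have hψd : ∀ x, ψ x = 0 → diagonal K x = 0 := fun x hx => by
    have := map_dvd (diagonal K) ((hψ x).1 hx)
    rwa [hdiag, zero_dvd_iff] at this
  have hfaith : FaithfulSMul (Poly2 K) E := by
    rw [faithfulSMul_iff_algebraMap_injective, injective_iff_map_eq_zero]
    intro x hx
    rw [← diagonal_C x]
    exact hψd _ ((ψ.commutes x).trans hx)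
  have hφ : ∀ x, x ≠ 0 → restrictTS ψ x ≠ 0 := fun x hx h => by
    rw [restrictTS_apply] at h
    have := hψd _ h
    rw [diagonal_map_C] at this
    exact hx this
  rw [algebraicIndependent_iff] at hdep
  push Not at hdep
  obtain ⟨g, hg, hg0⟩ := hdep
  have h1 : aeval (fun i => restrictTS ψ (a i) / restrictTS ψ (b i)) g = 0 := by
    refine aeval_div_eq_zero_of_aeval_div_eq_zero
      (ι := IsScalarTower.toAlgHom K (Poly2 K) (Rat2 K))
      (IsFractionRing.injective (Poly2 K) (Rat2 K)) hb ?_ _ fun i => hφ _ (hb i)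
    rw [← hg, funext hχ]
    rfl
  have h2 := (crossDiff_eq_zero_iff ψ (hb 1) (hφ _ (hb 1))).1 ((hψ _).2 hdvd)
  have hy : IsAlgebraic (Poly2 K) (restrictTS ψ (a 0) / restrictTS ψ (b 0)) := by
    refine isAlgebraic_of_aeval_cons_eq_zero (n := 1) (x := fun _ => χ 1) hg0 ?_ ?_
    · rwa [algebraicIndependent_unique_type_iff]
    · rw [← h1, hχ, ← h2]
      congr 2
      ext i
      fin_cases i <;> rfl
  have hy' : IsAlgebraic (Poly2 K) (liftRat K E (algebraMap (Poly2 K) (Rat2 K) (a 0) /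
      algebraMap (Poly2 K) (Rat2 K) (b 0))) := by
    rw [map_div₀, liftRat_algebraMap, liftRat_algebraMap, div_eq_mul_inv]
    exact (isAlgebraic_algebraMap _).mul (isAlgebraic_algebraMap _).inv
  rw [← hψ]
  refine eq_zero_of_isAlgebraic_div ψ (diagonal K) hψd (v := map C (b 0) * C (b 0)) ?_ ?_ ?_
  · rw [crossDiff, map_sub, map_mul, map_mul, diagonal_map_C, diagonal_map_C, diagonal_C,
      diagonal_C, sub_self]
  · rw [map_mul, diagonal_map_C, diagonal_C]
    exact mul_ne_zero (hb 0) (hb 0)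
  · have hC : ∀ x : Poly2 K, ψ (C x) = algebraMap (Poly2 K) E x := ψ.commutes
    have hb2 : algebraMap (Poly2 K) E (b 0) ≠ 0 :=
      (map_ne_zero_iff _ (FaithfulSMul.algebraMap_injective (Poly2 K) E)).2 (hb 0)
    have hb3 := hφ _ (hb 0)
    have h3 := hy.sub hy'
    rw [map_div₀, liftRat_algebraMap, liftRat_algebraMap, div_sub_div _ _ hb3 hb2] at h3
    rwa [crossDiff, map_sub, map_mul, map_mul, map_mul, hC, hC, ← restrictTS_apply,
      ← restrictTS_apply, mul_comm (algebraMap _ _ (a 0))]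

theorem not_dvd_C_of_totalDegree_pos {σ R : Type*} [CommRing R] [IsDomain R]
    {q : MvPolynomial σ R} (hq : 0 < q.totalDegree) {c : R} (hc : c ≠ 0) : ¬ q ∣ C c := by
  rintro ⟨s, hs⟩
  have h0 : q * s ≠ 0 := hs ▸ (C_ne_zero.2 hc)
  have := totalDegree_mul_of_isDomain (left_ne_zero_of_mul h0) (right_ne_zero_of_mul h0)
  rw [← hs, totalDegree_C] at this
  omega

theorem not_isRelPrime_of_dvd_map_C [Infinite K] {a b : Poly2 K} {q : Poly4 K}
    (hq : 0 < q.totalDegree) (ha : q ∣ map C a) (hb : q ∣ map C b) : ¬ IsRelPrime a b := by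
  intro hab
  obtain ⟨m, hm, hm0⟩ : ∃ m ∈ q.support, m ≠ 0 := by
    by_contra! h
    refine hq.ne' (Nat.eq_zero_of_le_zero (Finset.sup_le fun m hm => ?_))
    rw [h m hm]; simp
  obtain ⟨h0, hh0⟩ : ∃ p, eval p (q.coeff m) ≠ 0 := by
    by_contra! h
    exact mem_support_iff.1 hm (MvPolynomial.funext fun p => by rw [h p, map_zero])
  have hmap : ∀ x : Poly2 K, map (eval h0) (map C x : Poly4 K) = x := fun x => by
    rw [map_map]
    convert map_id x
    ext c; simp
  have h1 := map_dvd (map (eval h0)) ha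
  have h2 := map_dvd (map (eval h0)) hb
  rw [hmap] at h1 h2
  obtain ⟨c, -, hc⟩ := MvPolynomial.isUnit_iff_eq_C_of_isReduced.1 (hab h1 h2)
  have h3 := congrArg (coeff m) hc
  rw [coeff_map, coeff_C, if_neg hm0.symm] at h3
  exact hh0 h3

theorem degreeOf_eq_zero_of_dvd_aeval_X {σ R : Type*} [CommRing R] [IsDomain R]
    {q : MvPolynomial σ R} {i j : σ} (hij : i ≠ j) {r : Polynomial R} (hr : r ≠ 0)
    (h : q ∣ Polynomial.aeval (X j : MvPolynomial σ R) r) : degreeOf i q = 0 := by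
  obtain ⟨s, hs⟩ := h
  have h0 : Polynomial.aeval (X j : MvPolynomial σ R) r ≠ 0 := fun h =>
    hr ((transcendental_iff.1 (transcendental_X R j)) r h)
  have h1 : degreeOf i (Polynomial.aeval (X j : MvPolynomial σ R) r) = 0 := by
    have h2 : Polynomial.aeval (X j : MvPolynomial σ R) r ∈ supported R {j} := by
      rw [supported_eq_adjoin_X, Set.image_singleton]
      exact Polynomial.aeval_mem_adjoin_singleton _ _
    rw [mem_supported] at h2
    refine Nat.le_zero.1 (degreeOf_le_iff.2 fun m hm => (Nat.le_zero.2 ?_))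
    exact mem_support_notMem_vars_zero hm fun h3 => hij (h2 h3)
  rw [hs] at h0 h1
  rw [degreeOf_mul_eq (left_ne_zero_of_mul h0) (right_ne_zero_of_mul h0)] at h1
  omega

/-- If `χ₀` and `χ₁` are algebraically independent, the loci `χᵢ(t, s) = χᵢ(h₁, h₂)` have no common
component that dominates the `(h₁, h₂)`-plane. -/
theorem not_dvd_crossDiff_of_algebraicIndependent [Infinite K] {a b : Fin 2 → Poly2 K}
    (hb : ∀ i, b i ≠ 0) (hab : ∀ i, IsRelPrime (a i) (b i)) {χ : Fin 2 → Rat2 K}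
    (hχ : ∀ i, χ i = algebraMap (Poly2 K) (Rat2 K) (a i) / algebraMap (Poly2 K) (Rat2 K) (b i))
    (hind : AlgebraicIndependent K χ) {q : Poly4 K} (hq : Prime q) (hdeg : 0 < q.totalDegree) :
    ¬ ∀ i, q ∣ crossDiff (a i) (b i) := by
  intro hdvd
  obtain ⟨E, _, _, _, _, ψ, hψ⟩ := exists_fibre_field hq
  have hC : ∀ x : Poly2 K, ψ (C x) = algebraMap (Poly2 K) E x := ψ.commutes
  have hfaith : FaithfulSMul (Poly2 K) E := by
    rw [faithfulSMul_iff_algebraMap_injective, injective_iff_map_eq_zero]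
    intro x hx
    by_contra hx0
    exact not_dvd_C_of_totalDegree_pos hdeg hx0 ((hψ _).1 ((hC x).trans hx))
  have hφ : ∀ i, restrictTS ψ (b i) ≠ 0 := fun i h => by
    rw [restrictTS_apply, hψ] at h
    have h1 : q ∣ map C (a i) * C (b i) := by
      have := dvd_add (hdvd i) (h.mul_left (C (a i)))
      rwa [crossDiff, sub_add_cancel] at this
    exact not_isRelPrime_of_dvd_map_C hdeg ((hq.dvd_or_dvd h1).resolve_right
      (not_dvd_C_of_totalDegree_pos hdeg (hb i))) h (hab i)
  have halg : ∀ j, IsAlgebraic (Poly2 K) (ψ (X j)) := by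
    intro j
    obtain ⟨g, hg0, hg⟩ := exists_aeval_cons_eq_zero hind (algebraMap (Poly2 K) (Rat2 K) (X j))
    refine isAlgebraic_of_aeval_cons_eq_zero hg0 hind ?_
    let a' : Fin 3 → Poly2 K := Fin.cons (X j) a
    let b' : Fin 3 → Poly2 K := Fin.cons 1 b
    have hb' : ∀ i, b' i ≠ 0 := fun i => by
      refine Fin.cases ?_ (fun k => ?_) i
      · simp [b']
      · simpa [b'] using hb k
    have hφ' : ∀ i, restrictTS ψ (b' i) ≠ 0 := fun i => by
      refine Fin.cases ?_ (fun k => ?_) i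
      · simp [b']
      · simpa [b'] using hφ k
    have := aeval_div_eq_zero_of_aeval_div_eq_zero (a := a') (g := g)
      (ι := IsScalarTower.toAlgHom K (Poly2 K) (Rat2 K))
      (IsFractionRing.injective (Poly2 K) (Rat2 K)) hb' ?_ (restrictTS ψ) hφ'
    · rw [← this]
      congr 2
      ext i
      refine Fin.cases ?_ (fun k => ?_) i
      · simp [a', b', restrictTS]
      · rw [Fin.cons_succ, hχ, ← (crossDiff_eq_zero_iff ψ (hb k) (hφ k)).1 ((hψ _).2 (hdvd k))]
        simp [a', b']
    · rw [← hg]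
      congr 2
      ext i
      refine Fin.cases ?_ (fun k => ?_) i
      · simp [a', b']
      · simp [a', b', hχ]
  have hdvd' : ∀ j, ∃ r : Polynomial (Poly2 K), r ≠ 0 ∧
      q ∣ Polynomial.aeval (X j : Poly4 K) r := fun j => by
    obtain ⟨r, hr0, hr⟩ := halg j
    refine ⟨r, hr0, (hψ _).1 ?_⟩
    rw [← hr, Polynomial.aeval_algHom_apply]
  obtain ⟨r0, hr0, hd0⟩ := hdvd' 0
  obtain ⟨r1, hr1, hd1⟩ := hdvd' 1
  have h0 : ∀ i, degreeOf i q = 0 := fun i => by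
    fin_cases i
    · exact degreeOf_eq_zero_of_dvd_aeval_X (by decide) hr1 hd1
    · exact degreeOf_eq_zero_of_dvd_aeval_X (by decide) hr0 hd0
  refine hdeg.ne' ((totalDegree_eq_zero_iff (σ := Fin 2) (p := q)).2 fun m hm i => ?_)
  exact Nat.le_zero.1 (degreeOf_le_iff.1 (h0 i).le m hm)

end FibreField

section GcdDegree

variable {K : Type u} [Field K]

theorem exists_eq_C_mul_of_crossDiff_eq_zero [Infinite K] {a b : Poly2 K} (hb : b ≠ 0)
    (h : crossDiff a b = 0) : ∃ c : K, a = C c * b := by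
  obtain ⟨h0, hh0⟩ : ∃ p, eval p b ≠ 0 := by
    by_contra! h'
    exact hb (MvPolynomial.funext fun p => by rw [h' p, map_zero])
  have hmap : ∀ x : Poly2 K, map (eval h0) (map C x : Poly4 K) = x := fun x => by
    rw [map_map]
    convert map_id x
    ext c; simp
  have h1 := congrArg (map (eval h0)) h
  rw [crossDiff, map_sub, map_mul, map_mul, hmap, hmap, map_C, map_C, map_zero, sub_eq_zero] at h1
  refine ⟨eval h0 a / eval h0 b, ?_⟩
  rw [div_eq_mul_inv, C_mul, mul_assoc, mul_comm (C _) b, ← mul_assoc, ← h1, mul_assoc, ← C_mul,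
    mul_inv_cancel₀ hh0, C_1, mul_one]

theorem diffNumer_ne_zero_of_transcendental [Infinite K] {χ : Rat2 K} (hχ : Transcendental K χ) :
    diffNumer χ ≠ 0 := by
  intro h
  obtain ⟨a, b, hb, rfl⟩ := IsFractionRing.div_surjective (A := Poly2 K) χ
  have hb := nonZeroDivisors.ne_zero hb
  obtain ⟨d, e, -, he⟩ := exists_diffNumer_mul_eq (a := a) hb
  rw [h, zero_mul] at he
  obtain ⟨c, rfl⟩ := exists_eq_C_mul_of_crossDiff_eq_zero hb he.symm
  refine hχ ?_
  rw [map_mul, mul_div_cancel_right₀ _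
    ((map_ne_zero_iff _ (IsFractionRing.injective (Poly2 K) (Rat2 K))).2 hb)]
  have : algebraMap (Poly2 K) (Rat2 K) (C c) = algebraMap K (Rat2 K) c :=
    (IsScalarTower.algebraMap_apply K (Poly2 K) (Rat2 K) c).symm
  rw [this]
  exact isAlgebraic_algebraMap c

theorem exists_prime_dvd_of_not_algebraicIndependent [Infinite K] {χ : Fin 2 → Rat2 K}
    (hdep : ¬ AlgebraicIndependent K χ) {i : Fin 2} (htr : Transcendental K (χ i)) :
    ∃ q : Poly4 K, Prime q ∧ diagonal K q = 0 ∧ ∀ j, q ∣ diffNumer (χ j) := by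
  have hrep : ∀ j, ∃ a b : Poly2 K, b ≠ 0 ∧
      χ j = algebraMap (Poly2 K) (Rat2 K) a / algebraMap (Poly2 K) (Rat2 K) b := fun j => by
    obtain ⟨a, b, hb, h⟩ := IsFractionRing.div_surjective (A := Poly2 K) (χ j)
    exact ⟨a, b, nonZeroDivisors.ne_zero hb, h.symm⟩
  choose a b hb hχ using hrep
  have hdiag : diagonal K (diffNumer (χ i)) = 0 := by
    rw [hχ i]; exact diagonal_diffNumer (hb i)
  obtain ⟨q, hq, hqd, hq0⟩ :=
    exists_prime_dvd_diagonal_eq_zero (diffNumer_ne_zero_of_transcendental htr) hdiag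
  refine ⟨q, hq, hq0, ?_⟩
  obtain ⟨e, he⟩ : ∃ e : Equiv.Perm (Fin 2), e 1 = i := ⟨Equiv.swap 1 i, by simp⟩
  have h0 : q ∣ crossDiff (a (e 0)) (b (e 0)) := by
    refine dvd_crossDiff_of_not_algebraicIndependent (a := a ∘ e) (b := b ∘ e) (χ := χ ∘ e)
      (fun k => hb _) (fun k => hχ _) (by simpa [he]) ?_ hq hq0 ?_
    · rwa [algebraicIndependent_equiv]
    · simp only [Function.comp, he]
      exact dvd_crossDiff_of_dvd_diffNumer (hb i) (hχ i ▸ hqd)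
  intro j
  by_cases hj : j = i
  · exact hj ▸ hqd
  · have : e 0 = j := by
      have h1 : e 0 ≠ i := fun h => by
        have := e.injective (h.trans he.symm)
        simp at this
      omega
    rw [hχ j, dvd_diffNumer_iff (hb j) hq hq0, ← this]
    exact h0

theorem totalDegree_le_of_dvd {σ R : Type*} [CommRing R] [IsDomain R] {p q : MvPolynomial σ R}
    (h : p ∣ q) (hq : q ≠ 0) : p.totalDegree ≤ q.totalDegree := by
  obtain ⟨s, rfl⟩ := h
  rw [totalDegree_mul_of_isDomain (left_ne_zero_of_mul hq) (right_ne_zero_of_mul hq)]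
  exact Nat.le_add_right _ _

theorem totalDegree_pos_of_diagonal_eq_zero {q : Poly4 K} (hq : q ≠ 0) (h : diagonal K q = 0) :
    0 < q.totalDegree := by
  rw [Nat.pos_iff_ne_zero, Ne, totalDegree_eq_zero_iff_eq_C]
  intro hC
  rw [hC, diagonal_C] at h
  rw [h, C_0] at hC
  exact hq hC

theorem exists_prime_dvd_totalDegree_pos {σ R : Type*} [CommRing R] [IsDomain R]
    [UniqueFactorizationMonoid R] {g : MvPolynomial σ R} (hg : 0 < g.totalDegree) :
    ∃ q, Prime q ∧ q ∣ g ∧ 0 < q.totalDegree := by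
  have hg0 : g ≠ 0 := by rintro rfl; simp at hg
  obtain ⟨s, hs, hsg⟩ := UniqueFactorizationMonoid.exists_prime_factors g hg0
  by_contra! h
  have h1 : s.prod.totalDegree = 0 := by
    refine Nat.le_zero.1 ((totalDegree_multiset_prod s).trans (Nat.le_zero.2 ?_))
    refine Multiset.sum_eq_zero fun d hd => ?_
    obtain ⟨q, hqs, rfl⟩ := Multiset.mem_map.1 hd
    exact Nat.le_zero.1 (h q (hs q hqs) ((Multiset.dvd_prod hqs).trans hsg.dvd))
  have h2 := totalDegree_le_of_dvd hsg.symm.dvd (hsg.ne_zero_iff.2 hg0)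
  omega

theorem dvd_polyGcd_iff {p q r : Poly4 K} : r ∣ polyGcd p q ↔ r ∣ p ∧ r ∣ q :=
  letI : GCDMonoid (Poly4 K) := UniqueFactorizationMonoid.toGCDMonoid (Poly4 K)
  dvd_gcd_iff r p q

theorem polyGcd_totalDegree_pos_iff [Infinite K] {χ : Fin 2 → Rat2 K}
    (htr : ∃ i, Transcendental K (χ i)) :
    0 < (polyGcd (diffNumer (χ 0)) (diffNumer (χ 1))).totalDegree ↔
      ¬ AlgebraicIndependent K χ := by
  set G := polyGcd (diffNumer (χ 0)) (diffNumer (χ 1)) with hG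
  have hGd : ∀ i, G ∣ diffNumer (χ i) := fun i => by
    have := dvd_polyGcd_iff.1 (dvd_refl G)
    fin_cases i
    · exact this.1
    · exact this.2
  constructor
  · intro hpos hind
    obtain ⟨q, hq, hqG, hqpos⟩ := exists_prime_dvd_totalDegree_pos hpos
    have hrep : ∀ j, ∃ a b : Poly2 K, b ≠ 0 ∧ IsRelPrime a b ∧
        χ j = algebraMap (Poly2 K) (Rat2 K) a / algebraMap (Poly2 K) (Rat2 K) b := fun j => by
      obtain ⟨a, b, hab, h⟩ := IsFractionRing.exists_reduced_fraction (A := Poly2 K) (χ j)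
      exact ⟨a, b, nonZeroDivisors.ne_zero b.2, hab, by rw [← h, IsFractionRing.mk'_eq_div]⟩
    choose a b hb hab hχ using hrep
    refine not_dvd_crossDiff_of_algebraicIndependent hb hab hχ hind hq hqpos fun i => ?_
    exact dvd_crossDiff_of_dvd_diffNumer (hb i) (hχ i ▸ hqG.trans (hGd i))
  · intro hdep
    obtain ⟨i, hi⟩ := htr
    obtain ⟨q, hq, hq0, hqd⟩ := exists_prime_dvd_of_not_algebraicIndependent hdep hi
    have hG0 : G ≠ 0 := fun h => diffNumer_ne_zero_of_transcendental hi
      (zero_dvd_iff.1 (h ▸ hGd i))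
    exact (totalDegree_pos_of_diagonal_eq_zero hq.ne_zero hq0).trans_le
      (totalDegree_le_of_dvd (dvd_polyGcd_iff.2 ⟨hqd 0, hqd 1⟩) hG0)

end GcdDegree

variable {K : Type u} [Field K]

section Translation

theorem translate_translate (A : Fin 3 → K) (f : MvPolynomial (Fin 3) K) :
    translate (-A) (translate A f) = f := by
  have h : (aeval fun i => X i + C ((-A) i)).comp (aeval fun i => X i + C (A i)) =
      AlgHom.id K (MvPolynomial (Fin 3) K) := by
    ext1 i
    simp only [AlgHom.comp_apply, aeval_X, map_add, aeval_C, algebraMap_eq, AlgHom.id_apply,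
      Pi.neg_apply, map_neg]
    ring
  exact DFunLike.congr_fun h f

theorem translate_neg_translate (A : Fin 3 → K) (f : MvPolynomial (Fin 3) K) :
    translate A (translate (-A) f) = f := by
  simpa using translate_translate (-A) f

theorem translate_dvd_iff (A : Fin 3 → K) (f g : MvPolynomial (Fin 3) K) :
    translate A f ∣ g ↔ f ∣ translate (-A) g := by
  constructor
  · intro h
    have := map_dvd (aeval fun i => X i + C ((-A) i) : _ →ₐ[K] MvPolynomial (Fin 3) K) h
    rwa [show aeval _ (translate A f) = f from translate_translate A f] at this
  · intro h
    have := map_dvd (aeval fun i => X i + C (A i) : _ →ₐ[K] MvPolynomial (Fin 3) K) h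
    rwa [show aeval _ (translate (-A) g) = g from translate_neg_translate A g] at this

theorem totalDegree_translate_le (A : Fin 3 → K) (f : MvPolynomial (Fin 3) K) :
    (translate A f).totalDegree ≤ f.totalDegree := by
  rw [translate, aeval_def, eval₂_eq]
  refine totalDegree_finsetSum_le fun m hm => ?_
  refine (totalDegree_mul _ _).trans ?_
  rw [algebraMap_eq, totalDegree_C, zero_add]
  refine (totalDegree_finsetProd _ _).trans (le_trans ?_ (le_totalDegree hm))
  refine Finset.sum_le_sum fun i _ => (totalDegree_pow _ _).trans ?_
  have : (X i + C (A i) : MvPolynomial (Fin 3) K).totalDegree ≤ 1 := by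
    refine (totalDegree_add _ _).trans ?_
    simp
  simpa using Nat.mul_le_mul_left (m i) this

theorem totalDegree_translate (A : Fin 3 → K) (f : MvPolynomial (Fin 3) K) :
    (translate A f).totalDegree = f.totalDegree := by
  refine le_antisymm (totalDegree_translate_le A f) ?_
  conv_lhs => rw [← translate_translate A f]
  exact totalDegree_translate_le _ _

theorem translate_ne_zero (A : Fin 3 → K) {f : MvPolynomial (Fin 3) K} (hf : f ≠ 0) :
    translate A f ≠ 0 := by
  intro h
  rw [← translate_translate A f, h] at hf
  exact hf (map_zero (aeval fun i => X i + C ((-A) i) : _ →ₐ[K] MvPolynomial (Fin 3) K))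

theorem natTrailingDegree_gradingPoly {σ : Type*} {F : MvPolynomial σ K} (hF : F ≠ 0) :
    (gradingPoly F).natTrailingDegree = sInf {k | homogeneousComponent k F ≠ 0} := by
  have h1 : homogeneousComponent (gradingPoly F).natTrailingDegree F ≠ 0 := by
    rw [← coeff_gradingPoly]
    exact Polynomial.trailingCoeff_nonzero_iff_nonzero.2 (gradingPoly_ne_zero hF)
  refine le_antisymm (le_csInf ⟨_, h1⟩ fun k hk => ?_) (Nat.sInf_le h1)
  refine Polynomial.natTrailingDegree_le_of_ne_zero ?_
  rwa [coeff_gradingPoly]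

theorem mult_eq {A : Fin 3 → K} {Z : Set (Fin 3 → K)} (hZ : IsSurface Z) :
    mult A Z = (gradingPoly (translate A (definingPolynomial Z))).natTrailingDegree :=
  (natTrailingDegree_gradingPoly
    (translate_ne_zero A (definingPolynomial_spec hZ).1.ne_zero)).symm

theorem surfaceDegree_eq (A : Fin 3 → K) (Z : Set (Fin 3 → K)) :
    surfaceDegree Z = (gradingPoly (translate A (definingPolynomial Z))).natDegree := by
  rw [natDegree_gradingPoly, totalDegree_translate, surfaceDegree]

end Translation

section Parametrization

/-- The relations between the components of a parametrization of a surface are the multiples of the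
defining polynomial. -/
theorem aeval_paramMap_eq_zero_iff [IsAlgClosed K] {Z : Set (Fin 3 → K)} {N D : Fin 3 → Poly2 K}
    (hQ : IsRationalParametrization N D Z) {f : MvPolynomial (Fin 3) K}
    (hf : IsDefiningPolynomial Z f) (g : MvPolynomial (Fin 3) K) :
    aeval (paramMap N D) g = 0 ↔ f ∣ g := by
  have hinf : Infinite K := IsAlgClosed.instInfinite
  have h1 : vanishingIdeal K Z = Ideal.span {f} := by
    have hprime : (Ideal.span {f}).IsPrime :=
      (Ideal.span_singleton_prime hf.1.ne_zero).2 hf.1.prime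
    have hZ : Z = zeroLocus K (Ideal.span {f}) := by
      rw [zeroLocus_span, hf.2]
      ext x
      simp [aeval_eq_eval]
    rw [hZ, vanishingIdeal_zeroLocus_eq_radical, hprime.radical]
  have h2 : vanishingIdeal K Z = vanishingIdeal K (paramImage N D) := by
    rw [hQ.closure_image]
    exact (zeroLocus_vanishingIdeal_galoisConnection (k := K) (K := K) (σ := Fin 3)).u_l_u_eq_u _
  rw [← Ideal.mem_span_singleton, ← h1, h2, mem_vanishingIdeal_iff]
  obtain ⟨w, n, hw⟩ := exists_clear_denominators.{u} N D g
  have hι : Function.Injective (IsScalarTower.toAlgHom K (Poly2 K) (Rat2 K)) :=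
    IsFractionRing.injective (Poly2 K) (Rat2 K)
  have hD : ∏ i, D i ≠ 0 := Finset.prod_ne_zero_iff.2 fun i _ => hQ.den_ne_zero i
  have h3 := hw (Rat2 K) (IsScalarTower.toAlgHom K (Poly2 K) (Rat2 K)) fun i =>
    (map_ne_zero_iff _ hι).2 (hQ.den_ne_zero i)
  have h4 : aeval (paramMap N D) g = 0 ↔ w = 0 := by
    rw [← map_eq_zero_iff _ hι, ← h3, mul_eq_zero_iff_right]
    · rfl
    · exact pow_ne_zero _ ((map_ne_zero_iff _ hι).2 hD)
  rw [h4]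
  have h5 : ∀ p : Fin 2 → K, (∀ i, eval p (D i) ≠ 0) →
      (aeval (fun i => eval p (N i) / eval p (D i)) g = 0 ↔ eval p w = 0) := fun p hp => by
    have := hw K (aeval p) (by simpa [aeval_eq_eval] using hp)
    simp only [aeval_eq_eval] at this ⊢
    rw [← this, mul_eq_zero_iff_right]
    refine pow_ne_zero _ ?_
    rw [map_prod]
    exact Finset.prod_ne_zero_iff.2 fun i _ => hp i
  constructor
  · rintro rfl x ⟨p, hp, hx⟩
    rw [funext hx]
    exact (h5 p hp).2 (map_zero _)
  · intro h
    have h6 : w * ∏ i, D i = 0 := by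
      refine MvPolynomial.funext fun p => ?_
      rw [map_mul, map_prod, map_zero]
      by_cases hp : ∀ i, eval p (D i) ≠ 0
      · rw [(h5 p hp).1 (h _ ⟨p, hp, fun i => rfl⟩), zero_mul]
      · push Not at hp
        obtain ⟨i, hi⟩ := hp
        rw [Finset.prod_eq_zero (Finset.mem_univ i) hi, mul_zero]
    exact (mul_eq_zero.1 h6).resolve_right hD

theorem exists_eq_mul_C_of_dvd {σ : Type*} {f l : MvPolynomial σ K} (hf : Irreducible f)
    (h : f ∣ l) (hl : l ≠ 0) (hdeg : l.totalDegree ≤ 1) : ∃ c : K, c ≠ 0 ∧ l = f * C c := by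
  obtain ⟨s, rfl⟩ := h
  rw [totalDegree_mul_of_isDomain (left_ne_zero_of_mul hl) (right_ne_zero_of_mul hl)] at hdeg
  have h1 : f.totalDegree ≠ 0 := fun h0 => by
    have hC := totalDegree_eq_zero_iff_eq_C.1 h0
    refine hf.not_isUnit ?_
    rw [hC]
    refine (isUnit_iff_ne_zero.2 fun h2 => ?_).map C
    rw [h2, C_0] at hC
    exact hf.ne_zero hC
  have h2 := totalDegree_eq_zero_iff_eq_C.1 (show s.totalDegree = 0 by omega)
  refine ⟨_, fun h3 => ?_, congrArg _ h2⟩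
  rw [h3, C_0] at h2
  exact right_ne_zero_of_mul hl h2

end Parametrization

section Projection

/-- The components of the parametrization, relative to the point `A`. -/
def centredMap (N D : Fin 3 → Poly2 K) (A : Fin 3 → K) : Fin 3 → Rat2 K :=
  fun i => paramMap N D i - algebraMap K (Rat2 K) (A i)

theorem aeval_centredMap (N D : Fin 3 → Poly2 K) (A : Fin 3 → K) (g : MvPolynomial (Fin 3) K) :
    aeval (centredMap N D A) g = aeval (paramMap N D) (translate (-A) g) := by
  have h : (aeval (paramMap N D) : _ →ₐ[K] Rat2 K).comp (aeval fun i => X i + C ((-A) i)) =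
      aeval (centredMap N D A) := by
    ext1 i
    simp [centredMap, sub_eq_add_neg]
  exact (DFunLike.congr_fun h g).symm

theorem adjoin_centredMap (N D : Fin 3 → Poly2 K) (A : Fin 3 → K) :
    IntermediateField.adjoin K (Set.range (centredMap N D A)) =
      IntermediateField.adjoin K (Set.range (paramMap N D)) := by
  apply le_antisymm <;> rw [IntermediateField.adjoin_le_iff] <;> rintro _ ⟨i, rfl⟩
  · exact sub_mem (IntermediateField.subset_adjoin _ _ ⟨i, rfl⟩)
      (IntermediateField.algebraMap_mem _ _)
  · have h := add_mem (IntermediateField.subset_adjoin K (Set.range (centredMap N D A)) ⟨i, rfl⟩)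
      (IntermediateField.algebraMap_mem _ (A i))
    rwa [centredMap, sub_add_cancel] at h

theorem centredMap_eq_div {N D : Fin 3 → Poly2 K} (A : Fin 3 → K) (hD : ∀ i, D i ≠ 0) (i : Fin 3) :
    centredMap N D A i = algebraMap (Poly2 K) (Rat2 K) (N i - C (A i) * D i) /
      algebraMap (Poly2 K) (Rat2 K) (D i) := by
  have h : algebraMap (Poly2 K) (Rat2 K) (D i) ≠ 0 :=
    (map_ne_zero_iff _ (IsFractionRing.injective (Poly2 K) (Rat2 K))).2 (hD i)
  have hC : algebraMap (Poly2 K) (Rat2 K) (C (A i)) = algebraMap K (Rat2 K) (A i) :=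
    (IsScalarTower.algebraMap_apply K (Poly2 K) (Rat2 K) (A i)).symm
  rw [centredMap, paramMap, map_sub, map_mul, hC, sub_div, mul_div_cancel_right₀ _ h]

theorem Phi23_eq_div {N D : Fin 3 → Poly2 K} (A : Fin 3 → K) (hD : ∀ i, D i ≠ 0) (i : Fin 2) :
    Phi23 N D A i = centredMap N D A i.succ / centredMap N D A 0 := by
  rw [centredMap_eq_div A hD, centredMap_eq_div A hD, div_div_div_eq]
  fin_cases i
  · simp only [Phi23, Fin.zero_eta, Matrix.cons_val_zero, Fin.succ_zero_eq_one]
    rw [div_mul_div_comm, mul_comm (algebraMap _ _ (D 1))]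
  · simp only [Phi23, Fin.mk_one, Matrix.cons_val_one, Fin.succ_one_eq_two, Matrix.cons_val_fin_one]
    rw [div_mul_div_comm, mul_comm (algebraMap _ _ (D 2))]

variable [IsAlgClosed K] {Z : Set (Fin 3 → K)} {N D : Fin 3 → Poly2 K} {A : Fin 3 → K}

theorem aeval_centredMap_eq_zero_iff (hQ : IsRationalParametrization N D Z)
    {f : MvPolynomial (Fin 3) K} (hf : IsDefiningPolynomial Z f) (g : MvPolynomial (Fin 3) K) :
    aeval (centredMap N D A) g = 0 ↔ translate A f ∣ g := by
  rw [aeval_centredMap, aeval_paramMap_eq_zero_iff hQ hf, translate_dvd_iff]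

theorem centredMap_zero_ne_zero (hQ : IsRationalParametrization N D Z)
    {f : MvPolynomial (Fin 3) K} (hf : IsDefiningPolynomial Z f) (hplane : Z ≠ {x | x 0 = A 0}) :
    centredMap N D A 0 ≠ 0 := by
  intro h
  have h1 : f ∣ X 0 - C (A 0) := by
    have h2 : aeval (paramMap N D) (X 0 - C (A 0)) = 0 := by
      simpa [centredMap] using h
    exact (aeval_paramMap_eq_zero_iff hQ hf _).1 h2
  have h0 : (X 0 - C (A 0) : MvPolynomial (Fin 3) K) ≠ 0 := fun h3 => by
    have := congrArg (eval fun _ => A 0 + 1) h3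
    simp at this
  obtain ⟨c, hc, hfc⟩ := exists_eq_mul_C_of_dvd hf.1 h1 h0 (by
    refine (totalDegree_sub _ _).trans ?_
    simp)
  refine hplane ?_
  rw [hf.2]
  ext x
  have := congrArg (eval x) hfc
  simp only [map_sub, eval_X, eval_C, map_mul] at this
  rw [Set.mem_ofPred_eq, Set.mem_ofPred_eq, ← sub_eq_zero (a := x 0), this, mul_eq_zero_iff_right hc]

theorem transcendental_of_forall_ne_algebraMap {L : Type*} [Field L] [Algebra K L] {x : L}
    (h : ∀ c : K, x ≠ algebraMap K L c) : Transcendental K x := by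
  intro hx
  have h1 : IsIntegral K x := hx.isIntegral
  have h2 := IsAlgClosed.degree_eq_one_of_irreducible K (minpoly.irreducible h1)
  obtain ⟨c, hc⟩ := minpoly.mem_range_of_degree_eq_one K x h2
  exact h c hc.symm

theorem exists_transcendental_Phi23 (hQ : IsRationalParametrization N D Z)
    {f : MvPolynomial (Fin 3) K} (hf : IsDefiningPolynomial Z f) (hplane : Z ≠ {x | x 0 = A 0}) :
    ∃ i, Transcendental K (Phi23 N D A i) := by
  by_contra! h
  have h0 := centredMap_zero_ne_zero hQ hf hplane
  have h1 : ∀ i, ∃ c : K, Phi23 N D A i = algebraMap K (Rat2 K) c := fun i => by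
    by_contra! hc
    exact h i (transcendental_of_forall_ne_algebraMap hc)
  choose c hc using h1
  have hf' : Irreducible f := hf.1
  have h2 : ∀ i : Fin 2, ∃ u : K, u ≠ 0 ∧
      translate (-A) (X i.succ - C (c i) * X 0) = f * C u := fun i => by
    have h3 : aeval (centredMap N D A) (X i.succ - C (c i) * X 0) = 0 := by
      have h4 := Phi23_eq_div (N := N) A hQ.den_ne_zero i
      rw [hc, eq_div_iff h0] at h4
      simp [h4]
    have hne : (X i.succ - C (c i) * X 0 : MvPolynomial (Fin 3) K) ≠ 0 := fun h5 => by
      have := congrArg (eval (Pi.single i.succ 1)) h5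
      simp at this
    refine exists_eq_mul_C_of_dvd hf' ((translate_dvd_iff A f _).1
      ((aeval_centredMap_eq_zero_iff hQ hf _).1 h3)) (translate_ne_zero _ hne) ?_
    rw [totalDegree_translate]
    refine (totalDegree_sub _ _).trans (max_le (by simp) ((totalDegree_mul _ _).trans (by simp)))
  obtain ⟨u, hu, hu'⟩ := h2 0
  obtain ⟨v, hv, hv'⟩ := h2 1
  have h6 : ∀ p, eval p (X 1 - C (c 0) * X 0 : MvPolynomial (Fin 3) K) * v =
      eval p (X 2 - C (c 1) * X 0 : MvPolynomial (Fin 3) K) * u := fun p => by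
    have h7 : ∀ g, eval p g = eval (fun i => p i + A i) (translate (-A) g) := fun g => by
      conv_lhs => rw [← translate_neg_translate A g, translate]
      have h8 : (aeval p : _ →ₐ[K] K).comp (aeval fun i => X i + C (A i)) =
          aeval fun i => p i + A i := by
        ext1 i
        simp
      rw [← aeval_eq_eval, ← aeval_eq_eval]
      exact DFunLike.congr_fun h8 _
    rw [h7, h7]
    rw [show (X 1 - C (c 0) * X 0 : MvPolynomial (Fin 3) K) =
      X (Fin.succ 0) - C (c 0) * X 0 from rfl, hu',
      show (X 2 - C (c 1) * X 0 : MvPolynomial (Fin 3) K) =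
      X (Fin.succ 1) - C (c 1) * X 0 from rfl, hv']
    simp only [map_mul, eval_C]
    ring
  have := h6 ![0, 1, 0]
  simp at this
  exact hv this

end Projection

section Degree

variable [IsAlgClosed K] {Z : Set (Fin 3 → K)} {N D : Fin 3 → Poly2 K} {A : Fin 3 → K}

theorem gcdPolynomial_eq_one_iff (hZ : IsSurface Z) (hQ : IsRationalParametrization N D Z)
    (hplane : Z ≠ {x | x 0 = A 0}) :
    gcdPolynomial N D A = 1 ↔ AlgebraicIndependent K (Phi23 N D A) := by
  have hinf : Infinite K := IsAlgClosed.instInfinite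
  have h := polyGcd_totalDegree_pos_iff
    (exists_transcendental_Phi23 hQ (definingPolynomial_spec hZ) hplane)
  rw [← not_iff_not, ← h, gcdPolynomial]
  refine ⟨fun h1 => by_contra fun h2 => h1 (if_neg h2), fun h1 h2 => ?_⟩
  rw [if_pos h1] at h2
  rw [h2, totalDegree_one] at h1
  exact lt_irrefl _ h1

theorem coneTuple_Phi23 (hQ : IsRationalParametrization N D Z) (hZ : IsSurface Z)
    (hplane : Z ≠ {x | x 0 = A 0}) :
    coneTuple (Phi23 N D A) (centredMap N D A 0) = centredMap N D A := by
  rw [funext (Phi23_eq_div A hQ.den_ne_zero)]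
  exact cons_one_div_mul _ (centredMap_zero_ne_zero hQ (definingPolynomial_spec hZ) hplane)

theorem algebraicIndependent_Phi23_iff (hQ : IsRationalParametrization N D Z) (hZ : IsSurface Z)
    (hplane : Z ≠ {x | x 0 = A 0}) :
    AlgebraicIndependent K (Phi23 N D A) ↔ mult A Z < surfaceDegree Z := by
  have hf := definingPolynomial_spec hZ
  rw [mult_eq hZ, surfaceDegree_eq A]
  refine algebraicIndependent_iff_natTrailingDegree_lt (r := centredMap N D A 0)
    (translate_ne_zero A hf.1.ne_zero) (centredMap_zero_ne_zero hQ hf hplane) fun g => ?_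
  rw [coneTuple_Phi23 hQ hZ hplane]
  exact aeval_centredMap_eq_zero_iff hQ hf g

theorem ratMapDegree_Phi23 (hQ : IsRationalParametrization N D Z) (hZ : IsSurface Z)
    (hplane : Z ≠ {x | x 0 = A 0}) (hind : AlgebraicIndependent K (Phi23 N D A)) :
    ratMapDegree (Phi23 N D A) =
      (surfaceDegree Z - mult A Z) * ratMapDegree (paramMap N D) := by
  have hf := definingPolynomial_spec hZ
  have h := finrank_adjoin_eq_mul (r := centredMap N D A 0) (F := translate A (definingPolynomial Z))
    (translate_ne_zero A hf.1.ne_zero) (centredMap_zero_ne_zero hQ hf hplane) (fun g => by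
      rw [coneTuple_Phi23 hQ hZ hplane]
      exact aeval_centredMap_eq_zero_iff hQ hf g) hind
  rw [coneTuple_Phi23 hQ hZ hplane, adjoin_centredMap] at h
  rw [mult_eq hZ, surfaceDegree_eq A]
  exact h

end Degree

end RatSurf

end

theorem mainTheorem1 {K : Type*} [Field K] [IsAlgClosed K] [CharZero K]
    (Z : Set (Fin 3 → K)) (N D : Fin 3 → MvPolynomial (Fin 2) K) (A : Fin 3 → K)
    (hZ : RatSurf.IsSurface Z)
    (hQ : RatSurf.IsRationalParametrization N D Z)
    (hplane : ∀ (i : Fin 3) (c : K), Z ≠ {x | x i = c})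
    (hN : ∀ i, RatSurf.AvoidsInfinitePoint (N i))
    (hD : ∀ i, RatSurf.AvoidsInfinitePoint (D i))
    (hA : ∀ i, RatSurf.AvoidsInfinitePoint (N i - MvPolynomial.C (A i) * D i)) :
    (RatSurf.mult A Z = RatSurf.surfaceDegree Z ↔ RatSurf.gcdPolynomial N D A ≠ 1) ∧
    (RatSurf.mult A Z < RatSurf.surfaceDegree Z ↔ RatSurf.gcdPolynomial N D A = 1) ∧
    (RatSurf.gcdPolynomial N D A = 1 →
      (RatSurf.surfaceDegree Z : ℚ) - (RatSurf.mult A Z : ℚ) =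
        (RatSurf.ratMapDegree (RatSurf.Phi23 N D A) : ℚ) /
          (RatSurf.ratMapDegree (RatSurf.paramMap N D) : ℚ)) := by
  have hpl := hplane 0 (A 0)
  have hle : RatSurf.mult A Z ≤ RatSurf.surfaceDegree Z := by
    rw [RatSurf.mult_eq hZ, RatSurf.surfaceDegree_eq A]
    exact Polynomial.natTrailingDegree_le_natDegree _
  have h1 := RatSurf.gcdPolynomial_eq_one_iff hZ hQ hpl
  have h2 := RatSurf.algebraicIndependent_Phi23_iff hQ hZ hpl
  refine ⟨?_, (h1.trans h2).symm, fun hg => ?_⟩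
  · rw [Ne, h1, h2, not_lt]
    exact ⟨fun h => h.ge, fun h => le_antisymm hle h⟩
  · have hind := h1.1 hg
    have h3 := RatSurf.ratMapDegree_Phi23 hQ hZ hpl hind
    have h4 : RatSurf.ratMapDegree (RatSurf.Phi23 N D A) ≠ 0 := by
      have := RatSurf.finiteDimensional_adjoin_of_algebraicIndependent hind
      exact Module.finrank_pos.ne'
    have h5 : (RatSurf.ratMapDegree (RatSurf.paramMap N D) : ℚ) ≠ 0 := by
      rw [h3] at h4
      exact_mod_cast right_ne_zero_of_mul h4
    rw [h3, Nat.cast_mul, Nat.cast_sub hle, mul_div_cancel_right₀ _ h5]
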